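/- Let $b\ge 3$ and $m\ge 2$ be integers, let $D_b=\{0,1,\dots,b-1\}$, and let $\omega=\omega^0\omega^1\ldots$ be any sequence of words $\omega^k\in D_b^m$. Put $$\Sigma^\omega=\{(d_i)_{i\ge1}\in D_b^{\mathbb N}: d_{k+1}d_{k+2}\ldots d_{k+m}\neq\omega^k\ \text{ for all } k\ge 0\},\qquad K^\omega=\Big\{\sum_{i=1}^\infty d_i b^{-i}:(d_i)\in\Sigma^\omega\Big\}\subset[0,1],$$ and let $\Sigma_n^\omega=\{d_1\ldots d_n:(d_i)\in\Sigma^\omega\}$ be the set of prefixes of length $n$. For $\mathbf d\in D_b^m$ let $A_{\mathbf d}$ be the $0$-$1$ matrix indexed by $D_b^{m-1}\times D_b^{m-1}$ whose entry at $(u_1\ldots u_{m-1},v_1\ldots v_{m-1})$ is $1$ if and only if $u_2\ldots u_{m-1}=v_1\ldots v_{m-2}$ and $u_1\ldots u_{m-1}v_{m-1}\ne\mathbf d$, and let $\|A\|=\sum_{i,j}|a_{i,j}|$. Then $$\dim_H K^{\omega} = \underline{\dim}_B K^{\omega} = \liminf_{n \to \infty} \frac{\log |\Sigma_n^{\omega}|}{n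 \log b }=\liminf_{n\to\infty}\frac{1}{n \log b}\log \|A_{\omega^0}A_{\omega^1}\cdots A_{\omega^{n-1}}\|$$ and $$\dim_P K^{\omega} = \overline{\dim}_B K^{\omega} = \limsup_{n \to \infty} \frac{\log |\Sigma_n^{\omega}|}{n \log b}=\limsup_{n\to\infty}\frac{1}{n \log b}\log\|A_{\omega^0}A_{\omega^1}\cdots A_{\omega^{n-1}}\|,$$ where $\dim_H$, $\dim_P$, $\underline{\dim}_B$ and $\overline{\dim}_B$ denote the Hausdorff, packing, lower box and upper box dimensions. -/

import Mathlib

open Filter Topology Set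
open scoped ENNReal NNReal

namespace MovingHole

noncomputable section

/-! ### Fractal dimensions of subsets of the real line

The Hausdorff dimension is Mathlib's `dimH`. -/

/-- `N_δ(F)`: the smallest number of sets of diameter at most `δ` that cover `F`
(`⊤` if no finite number suffices). -/
def boxCount (δ : ℝ) (F : Set ℝ) : ℕ∞ :=
  ⨅ (n : ℕ) (_ : ∃ U : Fin n → Set ℝ,
    (∀ i, Metric.ediam (U i) ≤ ENNReal.ofReal δ) ∧ F ⊆ ⋃ i, U i), (n : ℕ∞)

/-- The quotient `log N_δ(F) / (-log δ)`. -/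
def boxRatio (F : Set ℝ) (δ : ℝ) : EReal :=
  ENNReal.log (boxCount δ F : ℝ≥0∞) / ((-Real.log δ : ℝ) : EReal)

/-- The lower box dimension: the lower limit of `log N_δ(F) / (-log δ)` as `δ → 0+`. -/
def lowerBoxDim (F : Set ℝ) : EReal := liminf (boxRatio F) (𝓝[>] (0 : ℝ))

/-- The upper box dimension: the upper limit of `log N_δ(F) / (-log δ)` as `δ → 0+`. -/
def upperBoxDim (F : Set ℝ) : EReal := limsup (boxRatio F) (𝓝[>] (0 : ℝ))

/-- `P` is a finite or countable collection of pairwise disjoint closed balls with centres in `F`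
and radii in `(0, δ]`; a ball is recorded as the pair (centre, radius). -/
def IsPacking (F : Set ℝ) (δ : ℝ) (P : Set (ℝ × ℝ)) : Prop :=
  P.Countable ∧ (∀ p ∈ P, p.1 ∈ F ∧ 0 < p.2 ∧ p.2 ≤ δ) ∧
    P.PairwiseDisjoint (fun p => Metric.closedBall p.1 p.2)

/-- `P^s_δ(F)`: the supremum of the sums of the `s`-th powers of the diameters (the diameter of a
ball of radius `r` in `ℝ` is `2 r`) over all `δ`-packings of `F`. -/
def packingPreAt (s : ℝ≥0) (δ : ℝ) (F : Set ℝ) : ℝ≥0∞ :=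
  ⨆ (P : Set (ℝ × ℝ)) (_ : IsPacking F δ P), ∑' p : P, ENNReal.ofReal (2 * p.1.2) ^ (s : ℝ)

/-- `P^s_0(F)`: the limit of `P^s_δ(F)` as `δ` decreases to `0`, which is the infimum over
`δ > 0` by monotonicity. -/
def packingPre (s : ℝ≥0) (F : Set ℝ) : ℝ≥0∞ :=
  ⨅ (δ : ℝ) (_ : 0 < δ), packingPreAt s δ F

/-- The `s`-dimensional packing measure: the infimum of `∑ P^s_0(F_i)` over all countable covers
`(F_i)` of `F`. -/
def packingMeasure (s : ℝ≥0) (F : Set ℝ) : ℝ≥0∞ :=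
  ⨅ (G : ℕ → Set ℝ) (_ : F ⊆ ⋃ i, G i), ∑' i, packingPre s (G i)

/-- The packing dimension: the supremum of all `s ≥ 0` such that the `s`-dimensional packing
measure of `F` is infinite. -/
def dimP (F : Set ℝ) : ℝ≥0∞ :=
  ⨆ (s : ℝ≥0) (_ : packingMeasure s F = ∞), (s : ℝ≥0∞)

/-! ### Survivor sets with a moving hole

The alphabet `D_b = {0, …, b - 1}` is `Fin b`, words of length `n` are functions
`Fin n → Fin b`, and infinite sequences are functions `ℕ → Fin b`; all letters are indexed from
`0`. -/

/-- The symbolic survivor set: all sequences `d` such that for every `k` the block of length `m`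
of `d` at position `k` differs from `ω k`. -/
def survivor {b m : ℕ} (ω : ℕ → Fin m → Fin b) : Set (ℕ → Fin b) :=
  {d | ∀ k : ℕ, (fun i : Fin m => d (k + i)) ≠ ω k}

/-- The set of prefixes of length `n` of the sequences in the symbolic survivor set. -/
def survivorWords {b m : ℕ} (ω : ℕ → Fin m → Fin b) (n : ℕ) : Set (Fin n → Fin b) :=
  (fun (d : ℕ → Fin b) (i : Fin n) => d i) '' survivor ω

/-- The projection `(d_1, d_2, …) ↦ ∑ d_i b^{-i}`. -/
def proj (b : ℕ) (d : ℕ → Fin b) : ℝ :=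
  ∑' i : ℕ, ((d i : ℕ) : ℝ) / (b : ℝ) ^ (i + 1)

/-- The survivor set in the unit interval. -/
def survivorSet {b m : ℕ} (ω : ℕ → Fin m → Fin b) : Set ℝ :=
  proj b '' survivor ω

/-- The adjacency matrix of the graph on the words of length `m - 1`, for the forbidden word `w`
of length `m = l + 2`: there is an edge from `u` to `v` if and only if
`u_2 … u_{m-1} = v_1 … v_{m-2}` and `u_1 … u_{m-1} v_{m-1} ≠ w`. -/
def adjMat {b l : ℕ} (w : Fin (l + 2) → Fin b) :
    Matrix (Fin (l + 1) → Fin b) (Fin (l + 1) → Fin b) ℝ :=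
  Matrix.of fun u v =>
    if (∀ i : Fin l, u i.succ = v i.castSucc) ∧
        (Fin.snoc u (v (Fin.last l)) : Fin (l + 2) → Fin b) ≠ w
    then 1 else 0

/-- The norm `‖A‖ = ∑ |a_{ij}|`. -/
def entryNorm {ι : Type*} [Fintype ι] (A : Matrix ι ι ℝ) : ℝ := ∑ i, ∑ j, |A i j|

/-- The product `A_{ω^0} A_{ω^1} ⋯ A_{ω^{n-1}}`. -/
def adjProd {b l : ℕ} (ω : ℕ → Fin (l + 2) → Fin b) (n : ℕ) :
    Matrix (Fin (l + 1) → Fin b) (Fin (l + 1) → Fin b) ℝ :=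
  ((List.range n).map fun k => adjMat (ω k)).prod

/-- `log |Σ_n^ω| / (n log b)`. -/
def wordRate {b m : ℕ} (ω : ℕ → Fin m → Fin b) (n : ℕ) : ℝ :=
  Real.log ((survivorWords ω n).ncard : ℝ) / ((n : ℝ) * Real.log (b : ℝ))

/-- `(1 / (n log b)) log ‖A_{ω^0} ⋯ A_{ω^{n-1}}‖`. -/
def normRate {b l : ℕ} (ω : ℕ → Fin (l + 2) → Fin b) (n : ℕ) : ℝ :=
  1 / ((n : ℝ) * Real.log (b : ℝ)) * Real.log (entryNorm (adjProd ω n))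

end

end MovingHole

namespace MovingHole

/-! ### Words, splicing, and the number of words in cylinders -/

/-! Write W_n for the number of prefixes of length n of Σ^ω, that is `wordCount (survivor ω) n`.
Everything rests on splicing (`exists_splice`): if b ≥ 3, a beginning of one survivor can be joined
to a tail of any other across a gap of l + 1 letters. A hole has length l + 2, so it never fits
inside the gap. A hole that meets the gap therefore threatens only one prefix or one suffix of the
gap word, one of each length. At most 2(1 + b + ⋯ + b^l) = 2(b^(l+1) - 1)/(b - 1) < b^(l+1) gap
words are lost.

Consequently Σ^ω is homogeneous. A level-n cylinder around a survivor has at least W_N / (b^(l+1)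
W_n) words of length N, and any level-n cylinder has at most b^(l+1) W_N / W_n of them when n ≤ N.
It is as if each such cylinder had mass about 1 / W_n.

The upper estimate gives a mass distribution principle in counting form (`one_le_tsum_of_cover`),
hence dim_H ≥ liminf; covers by cylinders give the converse. The lower estimate says that every
cylinder is as rich as the whole set. Combined with the Baire category theorem it makes the packing
measure infinite below the limsup (`packingMeasure_eq_top`); the converse codes the balls of a
packing by the words of their centres. For the box dimensions, a set of diameter at most b^(-n)
meets at most three cylinders of level n. Finally the norm of the matrix product equals W_(n+l+1)
(`entryNorm_adjProd`), and a bounded shift of n does not affect the rates. -/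

/-- The prefix of length `n` of a sequence. -/
def pfx {b : ℕ} (n : ℕ) (d : ℕ → Fin b) : Fin n → Fin b := fun i => d i

lemma pfx_eq_iff {b n : ℕ} {d e : ℕ → Fin b} : pfx n d = pfx n e ↔ ∀ i < n, d i = e i :=
  ⟨fun h i hi => congrFun h ⟨i, hi⟩, fun h => funext fun i => h i i.2⟩

/-- The number of prefixes of length `n` of the sequences in `A`. -/
noncomputable def wordCount {b : ℕ} (A : Set (ℕ → Fin b)) (n : ℕ) : ℕ := (pfx n '' A).ncard

lemma card_words (b n : ℕ) : Nat.card (Fin n → Fin b) = b ^ n := by simp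

lemma wordCount_mono {b n : ℕ} {A B : Set (ℕ → Fin b)} (h : A ⊆ B) :
    wordCount A n ≤ wordCount B n :=
  Set.ncard_le_ncard (image_mono h) (Set.toFinite _)

lemma wordCount_pos {b n : ℕ} {A : Set (ℕ → Fin b)} (h : A.Nonempty) : 0 < wordCount A n :=
  (Set.ncard_pos (Set.toFinite _)).2 (h.image _)

lemma wordCount_iUnion_le {b n : ℕ} {ι : Type*} [Fintype ι] (A : ι → Set (ℕ → Fin b)) :
    wordCount (⋃ i, A i) n ≤ ∑ i, wordCount (A i) n := by
  classical
  have h := Finset.set_ncard_biUnion_le (Finset.univ : Finset ι) (fun i => pfx n '' A i)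
  simpa [wordCount, image_iUnion] using h

lemma wordCount_biUnion_le {b n : ℕ} {ι : Type*} (s : Finset ι) (A : ι → Set (ℕ → Fin b)) :
    wordCount (⋃ i ∈ s, A i) n ≤ ∑ i ∈ s, wordCount (A i) n := by
  classical
  have h := Finset.set_ncard_biUnion_le s (fun i => pfx n '' A i)
  simpa [wordCount, image_iUnion] using h

lemma wordCount_le_pow {b n : ℕ} (A : Set (ℕ → Fin b)) : wordCount A n ≤ b ^ n := by
  have h := Set.ncard_le_ncard (subset_univ (pfx n '' A)) (Set.toFinite _)
  simpa [wordCount, Set.ncard_univ] using h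

lemma wordCount_le_add {b : ℕ} (A : Set (ℕ → Fin b)) (n k : ℕ) :
    wordCount A n ≤ wordCount A (n + k) := by
  have : pfx n '' A ⊆ (fun w : Fin (n + k) → Fin b => fun i : Fin n => w (i.castAdd k)) ''
      (pfx (n + k) '' A) := by
    rintro _ ⟨d, hd, rfl⟩
    exact ⟨_, ⟨d, hd, rfl⟩, rfl⟩
  exact (Set.ncard_le_ncard this (Set.toFinite _)).trans (Set.ncard_image_le (Set.toFinite _))

lemma wordCount_add_le {b : ℕ} (A : Set (ℕ → Fin b)) (n k : ℕ) :
    wordCount A (n + k) ≤ b ^ k * wordCount A n := by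
  have h := Set.ncard_le_ncard_of_injOn (s := pfx (n + k) '' A)
    (t := (pfx n '' A) ×ˢ (univ : Set (Fin k → Fin b)))
    (fun w => (fun i : Fin n => w (i.castAdd k), fun i : Fin k => w (i.natAdd n)))
    (by
      rintro _ ⟨d, hd, rfl⟩
      exact ⟨⟨d, hd, rfl⟩, mem_univ _⟩)
    (by
      intro w _ w' _ h
      simp only [Prod.mk.injEq] at h
      funext i
      induction i using Fin.addCases with
      | left i => exact congrFun h.1 i
      | right i => exact congrFun h.2 i) (Set.toFinite _)
  rw [Set.ncard_prod, Set.ncard_univ] at h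
  simpa [wordCount, mul_comm] using h

/-- The sequences that avoid the holes at the positions in `S`. -/
def avoiding {b m : ℕ} (ω : ℕ → Fin m → Fin b) (S : Set ℕ) : Set (ℕ → Fin b) :=
  {d | ∀ k ∈ S, (fun i : Fin m => d (k + i)) ≠ ω k}

lemma survivor_subset_avoiding {b m : ℕ} (ω : ℕ → Fin m → Fin b) (S : Set ℕ) :
    survivor ω ⊆ avoiding ω S := fun _ hd k _ => hd k

/-- A sequence avoiding the first `n` holes can be changed from the end of the last of them on so
that it avoids all holes. -/
lemma exists_survivor_extension {b l : ℕ} (hb : 2 ≤ b) (ω : ℕ → Fin (l + 2) → Fin b) (n : ℕ)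
    {d : ℕ → Fin b} (hd : d ∈ avoiding ω (Iio n)) :
    ∃ e ∈ survivor ω, ∀ i < n + (l + 1), e i = d i := by
  have : Nontrivial (Fin b) := Fin.nontrivial_iff_two_le.2 hb
  choose f hf using fun x : Fin b => exists_ne x
  -- A letter at a later position i is the last letter of exactly one window, the one at i - (l +
  -- 1). It is chosen to differ from the last letter of that hole.
  refine ⟨fun i => if i < n + (l + 1) then d i else f (ω (i - (l + 1)) (Fin.last _)), ?_,
    fun i hi => if_pos hi⟩
  intro k h
  by_cases hk : k < n
  · apply hd k hk
    rw [← h]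
    funext i
    have : k + (i : ℕ) < n + (l + 1) := by have := i.2; omega
    simp [this]
  · have h' := congrFun h (Fin.last (l + 1))
    have : ¬ k + (l + 1) < n + (l + 1) := by omega
    simp only [Fin.val_last, this, if_false, Nat.add_sub_cancel] at h'
    exact hf _ h'

lemma survivor_nonempty {b l : ℕ} (hb : 2 ≤ b) (ω : ℕ → Fin (l + 2) → Fin b) :
    (survivor ω).Nonempty := by
  obtain ⟨e, he, -⟩ := exists_survivor_extension hb ω 0 (d := fun _ => ⟨0, by omega⟩)
    (fun k hk => absurd hk (by simp))
  exact ⟨e, he⟩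

/-- The number of words of length `g` with prescribed letters at the positions in `T`. -/
lemma card_words_prescribed {b g : ℕ} (T : Finset (Fin g)) (p : Fin g → Fin b) :
    (Finset.univ.filter fun v : Fin g → Fin b => ∀ i ∈ T, v i = p i).card = b ^ (g - T.card) := by
  classical
  have : (Finset.univ.filter fun v : Fin g → Fin b => ∀ i ∈ T, v i = p i) =
      Fintype.piFinset fun i => if i ∈ T then {p i} else Finset.univ := by
    ext v
    simp only [Finset.mem_filter, Finset.mem_univ, true_and, Fintype.mem_piFinset]
    refine forall_congr' fun i => ?_
    by_cases h : i ∈ T <;> simp [h]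
  rw [this, Fintype.card_piFinset]
  have : ∀ i : Fin g, (if i ∈ T then {p i} else (Finset.univ : Finset (Fin b))).card =
      if i ∈ T then 1 else b := by
    intro i
    by_cases h : i ∈ T <;> simp [h]
  simp_rw [this]
  rw [Finset.prod_ite]
  simp only [Finset.prod_const_one, one_mul, Finset.prod_const]
  congr 1
  rw [Finset.filter_not, Finset.filter_mem_eq_inter, Finset.univ_inter,
    ← Finset.compl_eq_univ_sdiff, Finset.card_compl, Fintype.card_fin]

/-- If `b ≥ 3`, some word of length `g` has none of the prescribed nonempty prefixes, one for each
length, and none of the prescribed nonempty suffixes. -/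
lemma exists_word_avoiding_prefixes_suffixes {b g : ℕ} (hb : 3 ≤ b) (p q : Fin g → Fin g → Fin b) :
    ∃ v : Fin g → Fin b, (∀ j, ∃ i ≤ j, v i ≠ p j i) ∧ (∀ j, ∃ i ≥ j, v i ≠ q j i) := by
  classical
  by_contra! hcon
  let P : Fin g → Finset (Fin g → Fin b) := fun j =>
    Finset.univ.filter fun v => ∀ i ∈ Finset.Iic j, v i = p j i
  let Q : Fin g → Finset (Fin g → Fin b) := fun j =>
    Finset.univ.filter fun v => ∀ i ∈ Finset.Ici j, v i = q j i
  have hcov : (Finset.univ : Finset (Fin g → Fin b)) ⊆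
      Finset.univ.biUnion P ∪ Finset.univ.biUnion Q := by
    intro v _
    by_cases h : ∀ j, ∃ i ≤ j, v i ≠ p j i
    · obtain ⟨j, hj⟩ := hcon v h
      simp only [Finset.mem_union, Finset.mem_biUnion]
      exact Or.inr ⟨j, Finset.mem_univ _, by simpa [Q] using hj⟩
    · push Not at h
      obtain ⟨j, hj⟩ := h
      simp only [Finset.mem_union, Finset.mem_biUnion]
      exact Or.inl ⟨j, Finset.mem_univ _, by simpa [P] using hj⟩
  have hP : (Finset.univ.biUnion P).card ≤ ∑ i ∈ Finset.range g, b ^ i := by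
    refine Finset.card_biUnion_le.trans ?_
    -- A prefix ending at j fixes j + 1 letters and leaves b^(g-1-j) words; reversing j turns the
    -- exponents into 0, …, g - 1.
    rw [← Fin.sum_univ_eq_sum_range, ← Equiv.sum_comp Fin.revPerm]
    refine Finset.sum_le_sum fun j _ => ?_
    rw [card_words_prescribed, Fin.card_Iic]
    refine Nat.pow_le_pow_right (by omega) ?_
    simp only [Fin.revPerm_apply, Fin.val_rev]
    omega
  have hQ : (Finset.univ.biUnion Q).card ≤ ∑ i ∈ Finset.range g, b ^ i := by
    refine Finset.card_biUnion_le.trans ?_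
    rw [← Fin.sum_univ_eq_sum_range]
    refine Finset.sum_le_sum fun j _ => ?_
    rw [card_words_prescribed, Fin.card_Ici]
    refine Nat.pow_le_pow_right (by omega) ?_
    omega
  have h1 := Finset.card_le_card hcov
  have h2 := Finset.card_union_le (Finset.univ.biUnion P) (Finset.univ.biUnion Q)
  simp only [Finset.card_univ, Fintype.card_pi, Fintype.card_fin, Finset.prod_const] at h1
  have h4 : (∑ i ∈ Finset.range g, b ^ i) * (b - 1) + 1 = b ^ g := by
    obtain ⟨c, rfl⟩ : ∃ c, b = c + 1 := ⟨b - 1, by omega⟩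
    simpa using geom_sum_mul_add c g
  -- Here b ≥ 3 enters: twice the geometric sum is at most b^g - 1, so prefixes and suffixes cannot
  -- exclude every word.
  have h5 : (∑ i ∈ Finset.range g, b ^ i) * 2 ≤ (∑ i ∈ Finset.range g, b ^ i) * (b - 1) :=
    Nat.mul_le_mul_left _ (by omega)
  omega

/-- Any two sequences in the survivor set can be spliced across a gap of length `l + 1`. -/
lemma exists_splice {b l : ℕ} (hb : 3 ≤ b) (ω : ℕ → Fin (l + 2) → Fin b) (n : ℕ)
    {d e : ℕ → Fin b} (hd : d ∈ survivor ω) (he : e ∈ survivor ω) :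
    ∃ x ∈ survivor ω, (∀ i < n, x i = d i) ∧ ∀ i, n + (l + 1) ≤ i → x i = e i := by
  -- The window ending at gap position j starts at n + j - (l + 1), and it reads gap position i ≤ j
  -- as its letter l + 1 - j + i. The window starting at gap position j reads i ≥ j as its letter i
  -- - j. For other i the reduction in `Fin.ofNat` and truncated subtraction give values that are
  -- never used.
  obtain ⟨v, hv1, hv2⟩ := exists_word_avoiding_prefixes_suffixes hb
    (fun j i : Fin (l + 1) => ω (n + j - (l + 1)) (Fin.ofNat (l + 2) (l + 1 - j + i)))
    (fun j i : Fin (l + 1) => ω (n + j) (Fin.ofNat (l + 2) (i - j)))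
  let x : ℕ → Fin b := fun i =>
    if i < n then d i else if h : i - n < l + 1 then v ⟨i - n, h⟩ else e i
  have hx1 : ∀ i < n, x i = d i := fun i hi => if_pos hi
  have hx2 : ∀ i, n + (l + 1) ≤ i → x i = e i := fun i hi => by
    simp only [x]
    rw [if_neg (by omega), dif_neg (by omega)]
  have hx3 : ∀ i : Fin (l + 1), x (n + i) = v i := fun i => by
    simp only [x]
    rw [if_neg (by omega), dif_pos (by omega)]
    congr 1
    ext
    simp
  refine ⟨x, ?_, hx1, hx2⟩
  intro k hk
  -- A window starting before the gap misses it or covers a nonempty prefix of it; one starting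
  -- inside covers a suffix; one starting later sees only `e`.
  rcases Nat.lt_or_ge k n with hkn | hkn
  · rcases Nat.lt_or_ge n (k + (l + 2)) with hkn' | hkn'
    · obtain ⟨i, hi, hne⟩ := hv1 ⟨k + (l + 1) - n, by omega⟩
      have hi' : (i : ℕ) ≤ k + (l + 1) - n := hi
      apply hne
      have h1 : n + (k + (l + 1) - n) - (l + 1) = k := by omega
      have h2 : l + 1 - (k + (l + 1) - n) + (i : ℕ) < l + 2 := by omega
      have := congrFun hk ⟨_, h2⟩
      rw [← hx3]
      simp only [h1]
      rw [show Fin.ofNat (l + 2) (l + 1 - (k + (l + 1) - n) + (i : ℕ)) = ⟨_, h2⟩ from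
        Fin.ext (Nat.mod_eq_of_lt h2), ← this]
      congr 1
      simp only
      omega
    · apply hd k
      rw [← hk]
      funext i
      exact (hx1 _ (by omega)).symm
  · rcases Nat.lt_or_ge k (n + (l + 1)) with hkn' | hkn'
    · obtain ⟨i, hi, hne⟩ := hv2 ⟨k - n, by omega⟩
      have hi' : k - n ≤ (i : ℕ) := hi
      apply hne
      have h1 : n + (k - n) = k := by omega
      have h2 : (i : ℕ) - (k - n) < l + 2 := by omega
      have := congrFun hk ⟨_, h2⟩
      rw [← hx3]
      simp only [h1]
      rw [show Fin.ofNat (l + 2) ((i : ℕ) - (k - n)) = ⟨_, h2⟩ from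
        Fin.ext (Nat.mod_eq_of_lt h2), ← this]
      congr 1
      simp only
      omega
    · apply he k
      rw [← hk]
      funext i
      exact (hx2 _ (by omega)).symm

/-! ### Homogeneity: numbers of words in cylinders -/

/-- The sequences in the survivor set that agree with `x` on the first `n` letters. -/
def survivorCyl {b m : ℕ} (ω : ℕ → Fin m → Fin b) (x : ℕ → Fin b) (n : ℕ) : Set (ℕ → Fin b) :=
  survivor ω ∩ {y | ∀ i < n, y i = x i}

/-- Splice each prefix of length n with each word of the cylinder. The result determines the prefix
and the letters after the gap; the first n letters of the cylinder word are those of `x`, and its l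
+ 1 gap letters are recorded separately. -/
lemma mul_wordCount_survivorCyl_le {b l : ℕ} (hb : 3 ≤ b) (ω : ℕ → Fin (l + 2) → Fin b)
    (x : ℕ → Fin b) {n N : ℕ} (hn : n ≤ N) :
    wordCount (survivor ω) n * wordCount (survivorCyl ω x n) N ≤
      b ^ (l + 1) * wordCount (survivor ω) N := by
  classical
  have hE : ∀ u : ↥(pfx n '' survivor ω), ∃ d ∈ survivor ω, pfx n d = u := fun u => u.2
  have hF : ∀ w : ↥(pfx N '' survivorCyl ω x n), ∃ d ∈ survivorCyl ω x n, pfx N d = w :=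
    fun w => w.2
  choose E hE1 hE2 using hE
  choose F hF1 hF2 using hF
  choose S hS1 hS2 hS3 using fun u w => exists_splice hb ω n (hE1 u) (hF1 w).1
  let Φ : ↥(pfx n '' survivor ω) × ↥(pfx N '' survivorCyl ω x n) →
      ↥(pfx N '' survivor ω) × (Fin (l + 1) → Fin b) := fun p =>
    (⟨pfx N (S p.1 p.2), mem_image_of_mem _ (hS1 _ _)⟩, fun i => F p.2 (n + i))
  have hΦ : Function.Injective Φ := by
    rintro ⟨u, w⟩ ⟨u', w'⟩ h
    simp only [Φ, Prod.mk.injEq, Subtype.mk.injEq] at h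
    obtain ⟨h1, h2⟩ := h
    rw [pfx_eq_iff] at h1
    have hu : u = u' := by
      apply Subtype.ext
      rw [← hE2 u, ← hE2 u', pfx_eq_iff]
      intro i hi
      rw [← hS2 u w i hi, ← hS2 u' w' i hi]
      exact h1 i (by omega)
    have hw : w = w' := by
      apply Subtype.ext
      rw [← hF2 w, ← hF2 w', pfx_eq_iff]
      intro i hi
      rcases Nat.lt_or_ge i n with hin | hin
      · rw [(hF1 w).2 i hin, (hF1 w').2 i hin]
      · rcases Nat.lt_or_ge i (n + (l + 1)) with hin' | hin'
        · have := congrFun h2 ⟨i - n, by omega⟩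
          simpa [Nat.add_sub_cancel' hin] using this
        · rw [← hS3 u w i hin', ← hS3 u' w' i hin']
          exact h1 i hi
    rw [hu, hw]
  have := Nat.card_le_card_of_injective Φ hΦ
  simp only [Nat.card_prod, Nat.card_coe_set_eq, card_words] at this
  unfold wordCount
  linarith

/-- Splicing the beginning of `x` onto an arbitrary word lands in the cylinder and loses only the
first n letters and the gap letters of that word. -/
lemma wordCount_le_mul_wordCount_survivorCyl {b l : ℕ} (hb : 3 ≤ b) (ω : ℕ → Fin (l + 2) → Fin b)
    {x : ℕ → Fin b} (hx : x ∈ survivor ω) (n N : ℕ) :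
    wordCount (survivor ω) N ≤
      b ^ (l + 1) * wordCount (survivor ω) n * wordCount (survivorCyl ω x n) N := by
  classical
  have hF : ∀ w : ↥(pfx N '' survivor ω), ∃ d ∈ survivor ω, pfx N d = w := fun w => w.2
  choose F hF1 hF2 using hF
  choose S hS1 hS2 hS3 using fun w => exists_splice hb ω n hx (hF1 w)
  let Φ : ↥(pfx N '' survivor ω) →
      ↥(pfx n '' survivor ω) × ↥(pfx N '' survivorCyl ω x n) × (Fin (l + 1) → Fin b) := fun w =>
    (⟨pfx n (F w), mem_image_of_mem _ (hF1 _)⟩,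
      ⟨pfx N (S w), mem_image_of_mem _ ⟨hS1 _, hS2 _⟩⟩, fun i => F w (n + i))
  have hΦ : Function.Injective Φ := by
    intro w w' h
    simp only [Φ, Prod.mk.injEq, Subtype.mk.injEq, pfx_eq_iff] at h
    obtain ⟨h0, h1, h2⟩ := h
    apply Subtype.ext
    rw [← hF2 w, ← hF2 w', pfx_eq_iff]
    intro i hi
    rcases Nat.lt_or_ge i n with hin | hin
    · exact h0 i hin
    · rcases Nat.lt_or_ge i (n + (l + 1)) with hin' | hin'
      · have := congrFun h2 ⟨i - n, by omega⟩
        simpa [Nat.add_sub_cancel' hin] using this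
      · rw [← hS3 w i hin', ← hS3 w' i hin']
        exact h1 i hi
  have := Nat.card_le_card_of_injective Φ hΦ
  simp only [Nat.card_prod, Nat.card_coe_set_eq, card_words] at this
  unfold wordCount
  linarith

/-! ### Projections of cylinders -/

lemma proj_eq_ofDigits {b : ℕ} (d : ℕ → Fin b) : proj b d = Real.ofDigits d := rfl

lemma continuous_proj {b : ℕ} : Continuous (proj b) := Real.continuous_ofDigits

/-- The integer whose base `b` expansion consists of the first `n` letters of `d`. -/
def prefixValue {b : ℕ} (d : ℕ → Fin b) : ℕ → ℕ
  | 0 => 0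
  | n + 1 => b * prefixValue d n + d n

lemma eq_of_prefixValue_eq {b : ℕ} {d e : ℕ → Fin b} {n : ℕ}
    (h : prefixValue d n = prefixValue e n) : ∀ i < n, d i = e i := by
  induction n with
  | zero => intro i hi; omega
  | succ n ih =>
    simp only [prefixValue] at h
    have h1 : (d n : ℕ) = e n := by
      have := congrArg (· % b) h
      simpa [Nat.mod_eq_of_lt (d n).2, Nat.mod_eq_of_lt (e n).2] using this
    have hb : 0 < b := Fin.pos (d 0)
    rw [h1] at h
    have h2 := ih (Nat.eq_of_mul_eq_mul_left hb (Nat.add_right_cancel h))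
    intro i hi
    rcases Nat.lt_succ_iff_lt_or_eq.1 hi with hi | rfl
    · exact h2 i hi
    · exact Fin.ext h1

lemma sum_ofDigitsTerm_eq {b : ℕ} (d : ℕ → Fin b) (n : ℕ) :
    ∑ i ∈ Finset.range n, Real.ofDigitsTerm d i = ((b : ℝ) ^ n)⁻¹ * prefixValue d n := by
  have hb : (b : ℝ) ≠ 0 := by have := Fin.pos (d 0); positivity
  induction n with
  | zero => simp [prefixValue]
  | succ n ih =>
    rw [Finset.sum_range_succ, ih, Real.ofDigitsTerm, prefixValue]
    push_cast
    field_simp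
    ring

lemma prefixValue_le_proj {b : ℕ} (d : ℕ → Fin b) (n : ℕ) :
    ((b : ℝ) ^ n)⁻¹ * prefixValue d n ≤ proj b d := by
  rw [proj_eq_ofDigits, Real.ofDigits_eq_sum_add_ofDigits d n, sum_ofDigitsTerm_eq]
  have := Real.ofDigits_nonneg fun i => d (i + n)
  have : 0 ≤ ((b : ℝ) ^ n)⁻¹ * Real.ofDigits (fun i => d (i + n)) := by positivity
  linarith

lemma proj_le_prefixValue {b : ℕ} (d : ℕ → Fin b) (n : ℕ) :
    proj b d ≤ ((b : ℝ) ^ n)⁻¹ * (prefixValue d n + 1) := by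
  rw [proj_eq_ofDigits, Real.ofDigits_eq_sum_add_ofDigits d n, sum_ofDigitsTerm_eq, mul_add]
  gcongr
  exact Real.ofDigits_le_one _

lemma abs_proj_sub_proj_le {b : ℕ} {d e : ℕ → Fin b} {n : ℕ} (h : ∀ i < n, d i = e i) :
    |proj b d - proj b e| ≤ ((b : ℝ) ^ n)⁻¹ := Real.abs_ofDigits_sub_ofDigits_le h

lemma ediam_proj_image_le {b : ℕ} {A : Set (ℕ → Fin b)} {n : ℕ}
    (h : ∀ d ∈ A, ∀ e ∈ A, ∀ i < n, d i = e i) :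
    Metric.ediam (proj b '' A) ≤ ENNReal.ofReal ((b : ℝ) ^ n)⁻¹ := by
  refine Metric.ediam_le ?_
  rintro _ ⟨d, hd, rfl⟩ _ ⟨e, he, rfl⟩
  rw [edist_dist, Real.dist_eq]
  exact ENNReal.ofReal_le_ofReal (abs_proj_sub_proj_le (h d hd e he))

/-- Sequences whose projections are close have nearby prefix values. -/
lemma prefixValue_le_add {b : ℕ} {d e : ℕ → Fin b} {n c : ℕ}
    (h : proj b e - proj b d ≤ c * ((b : ℝ) ^ n)⁻¹) : prefixValue e n ≤ prefixValue d n + c + 1 := by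
  have hb : (0 : ℝ) < b := by have := Fin.pos (d 0); positivity
  have h1 := prefixValue_le_proj e n
  have h2 := proj_le_prefixValue d n
  have h3 : ((b : ℝ) ^ n)⁻¹ * prefixValue e n ≤ ((b : ℝ) ^ n)⁻¹ * (prefixValue d n + c + 1) := by
    linarith
  have h4 := le_of_mul_le_mul_left h3 (by positivity)
  exact_mod_cast h4

/-- A set of diameter at most `b ^ (-n)` meets at most three cylinders of level `n`. -/
lemma wordCount_le_three {b : ℕ} {A : Set (ℕ → Fin b)} {S : Set ℝ} {n : ℕ}
    (hS : Metric.ediam S ≤ ENNReal.ofReal ((b : ℝ) ^ n)⁻¹) (hA : ∀ d ∈ A, proj b d ∈ S) :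
    wordCount A n ≤ 3 := by
  rcases A.eq_empty_or_nonempty with rfl | hne
  · simp [wordCount]
  -- Relative to the smallest prefix value, the others exceed it by at most 2: one for the diameter,
  -- one for the length of a cylinder interval.
  obtain ⟨d₀, hd₀, hmin⟩ : ∃ d₀ ∈ A, ∀ d ∈ A, prefixValue d₀ n ≤ prefixValue d n := by
    obtain ⟨d₀, hd₀, h⟩ := (measure fun d : ℕ → Fin b => prefixValue d n).wf.has_min A hne
    exact ⟨d₀, hd₀, fun d hd => not_lt.1 (h d hd)⟩
  have : Nonempty (ℕ → Fin b) := ⟨d₀⟩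
  choose! F hF1 hF2 using fun w (hw : w ∈ pfx n '' A) => hw
  have h := Set.ncard_le_ncard_of_injOn (s := pfx n '' A)
    (t := Icc (prefixValue d₀ n) (prefixValue d₀ n + 2)) (fun w => prefixValue (F w) n)
    (by
      intro w hw
      refine ⟨hmin _ (hF1 w hw), prefixValue_le_add (c := 1) ?_⟩
      have h1 := (Metric.edist_le_ediam_of_mem (hA _ (hF1 w hw)) (hA _ hd₀)).trans hS
      rw [edist_dist, Real.dist_eq, ENNReal.ofReal_le_ofReal_iff (by positivity)] at h1
      simpa using (le_abs_self _).trans h1)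
    (by
      intro w hw w' hw' h
      rw [← hF2 w hw, ← hF2 w' hw', pfx_eq_iff]
      exact eq_of_prefixValue_eq h)
  rw [← Finset.coe_Icc, Set.ncard_coe_finset, Nat.card_Icc] at h
  have h' : wordCount A n ≤ _ := h
  omega

/-- A third of the words of level `n` give points which are `2 b ^ (-n)`-separated. -/
lemma exists_separated {b : ℕ} (A : Set (ℕ → Fin b)) (n : ℕ) :
    ∃ T : Finset (ℕ → Fin b), (T : Set (ℕ → Fin b)) ⊆ A ∧ wordCount A n ≤ 3 * T.card ∧
      ∀ d ∈ T, ∀ e ∈ T, d ≠ e → 2 * ((b : ℝ) ^ n)⁻¹ ≤ |proj b d - proj b e| := by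
  classical
  rcases A.eq_empty_or_nonempty with rfl | hne
  · exact ⟨∅, by simp, by simp [wordCount], by simp⟩
  have : Nonempty (ℕ → Fin b) := ⟨hne.some⟩
  choose! F hF1 hF2 using fun w (hw : w ∈ pfx n '' A) => hw
  have hfin : (pfx n '' A).Finite := Set.toFinite _
  -- Pigeonhole on prefix values modulo 3. Distinct words in one class have values at least 3 apart;
  -- the interval of a word takes up one unit, leaving a distance of two.
  obtain ⟨r, -, hr⟩ : ∃ r ∈ Finset.range 3, (pfx n '' A).ncard ≤
      3 * (hfin.toFinset.filter fun w => prefixValue (F w) n % 3 = r).card := by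
    by_contra! hcon
    have h1 := Finset.card_eq_sum_card_fiberwise (s := hfin.toFinset) (t := Finset.range 3)
      (f := fun w => prefixValue (F w) n % 3)
      (fun w _ => by simpa using Nat.mod_lt _ (by norm_num))
    rw [← Set.ncard_eq_toFinset_card _ hfin] at h1
    simp only [Finset.sum_range_succ, Finset.sum_range_zero] at h1
    have a0 := hcon 0 (by simp)
    have a1 := hcon 1 (by simp)
    have a2 := hcon 2 (by simp)
    omega
  refine ⟨(hfin.toFinset.filter fun w => prefixValue (F w) n % 3 = r).image F, ?_, ?_, ?_⟩
  · intro d hd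
    simp only [Finset.coe_image, Set.mem_image, Finset.mem_coe, Finset.mem_filter,
      Set.Finite.mem_toFinset] at hd
    obtain ⟨w, ⟨hw, -⟩, rfl⟩ := hd
    exact hF1 w hw
  · rw [Finset.card_image_of_injOn]
    · exact hr
    · intro w hw w' hw' h
      simp only [Finset.mem_coe, Finset.mem_filter, Set.Finite.mem_toFinset] at hw hw'
      rw [← hF2 w hw.1, ← hF2 w' hw'.1, h]
  · have key : ∀ d e : ℕ → Fin b, prefixValue d n % 3 = prefixValue e n % 3 →
        prefixValue d n < prefixValue e n → 2 * ((b : ℝ) ^ n)⁻¹ ≤ |proj b d - proj b e| := by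
      intro d e h1 h2
      have h3 : prefixValue d n + 3 ≤ prefixValue e n := by omega
      have h4 : (prefixValue d n : ℝ) + 3 ≤ prefixValue e n := by exact_mod_cast h3
      have h5 := prefixValue_le_proj e n
      have h6 := proj_le_prefixValue d n
      have h7 : ((b : ℝ) ^ n)⁻¹ * (prefixValue d n + 3) ≤ ((b : ℝ) ^ n)⁻¹ * prefixValue e n := by
        gcongr
      rw [abs_sub_comm]
      refine le_trans ?_ (le_abs_self _)
      linarith
    intro d hd e he hne
    simp only [Finset.mem_image, Finset.mem_filter, Set.Finite.mem_toFinset] at hd he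
    obtain ⟨w, ⟨hw, hwr⟩, rfl⟩ := hd
    obtain ⟨w', ⟨hw', hwr'⟩, rfl⟩ := he
    rcases lt_trichotomy (prefixValue (F w) n) (prefixValue (F w') n) with h | h | h
    · exact key _ _ (hwr.trans hwr'.symm) h
    · refine absurd ?_ hne
      have := eq_of_prefixValue_eq h
      rw [← pfx_eq_iff, hF2 w hw, hF2 w' hw'] at this
      rw [this]
    · rw [abs_sub_comm]
      exact key _ _ (hwr'.trans hwr.symm) h

lemma isClosed_survivor {b m : ℕ} (ω : ℕ → Fin m → Fin b) : IsClosed (survivor ω) := by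
  have : survivor ω = ⋂ k, (fun d : ℕ → Fin b => fun i : Fin m => d (k + i)) ⁻¹' {ω k}ᶜ := by
    ext d
    simp [survivor]
  rw [this]
  refine isClosed_iInter fun k => (isClosed_discrete _).preimage ?_
  fun_prop

lemma isOpen_agree {b : ℕ} (x : ℕ → Fin b) (n : ℕ) : IsOpen {y : ℕ → Fin b | ∀ i < n, y i = x i} :=
  PiNat.isOpen_cylinder (fun _ => Fin b) x n

/-! ### Bounds for the Hausdorff measure -/

lemma ofReal_inv_pow_rpow {b : ℕ} (hb : 0 < b) (n : ℕ) (s : ℝ) :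
    ENNReal.ofReal ((b : ℝ) ^ n)⁻¹ ^ s = ENNReal.ofReal ((b : ℝ) ^ (s * n))⁻¹ := by
  have hb' : (0 : ℝ) < b := by exact_mod_cast hb
  rw [ENNReal.ofReal_rpow_of_pos (by positivity), Real.inv_rpow (by positivity),
    ← Real.rpow_natCast, ← Real.rpow_mul hb'.le, mul_comm]

lemma tendsto_ofReal_inv_pow {b : ℕ} (hb : 2 ≤ b) :
    Tendsto (fun n : ℕ => ENNReal.ofReal ((b : ℝ) ^ n)⁻¹) atTop (𝓝 0) := by
  have hb' : (1 : ℝ) < b := by exact_mod_cast hb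
  rw [← ENNReal.ofReal_zero]
  refine ENNReal.tendsto_ofReal ?_
  exact (tendsto_pow_atTop_atTop_of_one_lt hb').inv_tendsto_atTop

open MeasureTheory in
-- The cylinders of level n cover with total mass W_n b^(-sn). Infinitely many good levels suffice,
-- since the measure is bounded by a lower limit of such sums.
lemma hausdorffMeasure_le_one {b m : ℕ} (hb : 2 ≤ b) (ω : ℕ → Fin m → Fin b) {s : ℝ}
    (hs : 0 ≤ s) (h : ∃ᶠ n : ℕ in atTop, (wordCount (survivor ω) n : ℝ) ≤ (b : ℝ) ^ (s * n)) :
    μH[s] (survivorSet ω) ≤ 1 := by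
  classical
  have hb' : (0 : ℝ) < b := by positivity
  let _ : ∀ n, Fintype ↥(pfx n '' survivor ω) := fun n => Fintype.ofFinite _
  let t : ∀ n, ↥(pfx n '' survivor ω) → Set ℝ := fun n w =>
    proj b '' {d | d ∈ survivor ω ∧ pfx n d = w}
  have ht : ∀ n w, Metric.ediam (t n w) ≤ ENNReal.ofReal ((b : ℝ) ^ n)⁻¹ := fun n w =>
    ediam_proj_image_le fun d hd e he => pfx_eq_iff.1 (hd.2.trans he.2.symm)
  refine (Measure.hausdorffMeasure_le_liminf_sum s _ _ (tendsto_ofReal_inv_pow hb) t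
    (Eventually.of_forall ht) (Eventually.of_forall fun n => ?_)).trans ?_
  · rintro _ ⟨d, hd, rfl⟩
    exact mem_iUnion.2 ⟨⟨pfx n d, mem_image_of_mem _ hd⟩, d, ⟨hd, rfl⟩, rfl⟩
  · refine liminf_le_of_frequently_le' (h.mono fun n hn => ?_)
    calc ∑ w, Metric.ediam (t n w) ^ s
        ≤ ∑ _w : ↥(pfx n '' survivor ω), ENNReal.ofReal ((b : ℝ) ^ n)⁻¹ ^ s :=
          Finset.sum_le_sum fun w _ => ENNReal.rpow_le_rpow (ht n w) hs
      _ = ENNReal.ofReal (wordCount (survivor ω) n * ((b : ℝ) ^ (s * n))⁻¹) := by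
          rw [Finset.sum_const, Finset.card_univ, ofReal_inv_pow_rpow (by omega),
            ENNReal.ofReal_mul (by positivity), ENNReal.ofReal_natCast, nsmul_eq_mul,
            ← Nat.card_eq_fintype_card, Nat.card_coe_set_eq]
          rfl
      _ ≤ 1 := by
          rw [← ENNReal.ofReal_one]
          refine ENNReal.ofReal_le_ofReal ?_
          rw [← div_eq_mul_inv]
          exact div_le_one_of_le₀ hn (by positivity)

/-- A set of small diameter captures a small proportion of the words. -/
lemma wordCount_near_mul_le {b l : ℕ} (hb : 3 ≤ b) (ω : ℕ → Fin (l + 2) → Fin b) {S : Set ℝ}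
    {n N : ℕ} (hn : n ≤ N) (hS : Metric.ediam S ≤ ENNReal.ofReal ((b : ℝ) ^ n)⁻¹) :
    wordCount (survivor ω ∩ {d | ∃ e ∈ survivor ω, proj b e ∈ S ∧ ∀ j < n, d j = e j}) N *
      wordCount (survivor ω) n ≤ 3 * b ^ (l + 1) * wordCount (survivor ω) N := by
  classical
  let B : Set (ℕ → Fin b) := {e | e ∈ survivor ω ∧ proj b e ∈ S}
  have : Nonempty (ℕ → Fin b) := ⟨fun _ => ⟨0, by omega⟩⟩
  choose! F hF1 hF2 using fun w (hw : w ∈ pfx n '' B) => hw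
  have hfin : (pfx n '' B).Finite := Set.toFinite _
  have hsub : survivor ω ∩ {d | ∃ e ∈ survivor ω, proj b e ∈ S ∧ ∀ j < n, d j = e j} ⊆
      ⋃ w ∈ hfin.toFinset, survivorCyl ω (F w) n := by
    rintro d ⟨hd, e, he, heS, hde⟩
    have hw : pfx n e ∈ pfx n '' B := mem_image_of_mem _ ⟨he, heS⟩
    simp only [mem_iUnion, Set.Finite.mem_toFinset]
    refine ⟨_, hw, hd, fun i hi => ?_⟩
    rw [hde i hi]
    exact (pfx_eq_iff.1 (hF2 _ hw) i hi).symm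
  have hcard : hfin.toFinset.card ≤ 3 := by
    rw [← Set.ncard_eq_toFinset_card _ hfin]
    exact wordCount_le_three hS fun d hd => hd.2
  calc _ ≤ (∑ w ∈ hfin.toFinset, wordCount (survivorCyl ω (F w) n) N) *
        wordCount (survivor ω) n :=
        Nat.mul_le_mul_right _ ((wordCount_mono hsub).trans (wordCount_biUnion_le _ _))
    _ = ∑ w ∈ hfin.toFinset, wordCount (survivor ω) n * wordCount (survivorCyl ω (F w) n) N := by
        rw [mul_comm, Finset.mul_sum]
    _ ≤ ∑ _w ∈ hfin.toFinset, b ^ (l + 1) * wordCount (survivor ω) N :=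
        Finset.sum_le_sum fun w _ => mul_wordCount_survivorCyl_le hb ω _ hn
    _ = hfin.toFinset.card * (b ^ (l + 1) * wordCount (survivor ω) N) := by simp
    _ ≤ 3 * (b ^ (l + 1) * wordCount (survivor ω) N) := Nat.mul_le_mul_right _ hcard
    _ = _ := by ring

/-- Every countable cover of the survivor set has total mass at least `1`. -/
lemma one_le_tsum_of_cover {b l : ℕ} (hb : 3 ≤ b) (ω : ℕ → Fin (l + 2) → Fin b) (t : ℕ → Set ℝ)
    (n : ℕ → ℕ) (ht : ∀ i, Metric.ediam (t i) ≤ ENNReal.ofReal ((b : ℝ) ^ n i)⁻¹)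
    (hcov : survivorSet ω ⊆ ⋃ i, t i) :
    1 ≤ ∑' i, (3 * b ^ (l + 1) : ℕ) * (wordCount (survivor ω) (n i) : ℝ≥0∞)⁻¹ := by
  classical
  -- The sets `t i` are arbitrary, so each is enlarged in symbol space to the union of the level-`n
  -- i` cylinders it meets. These are open, and compactness leaves finitely many.
  let V : ℕ → Set (ℕ → Fin b) := fun i =>
    {d | ∃ e ∈ survivor ω, proj b e ∈ t i ∧ ∀ j < n i, d j = e j}
  have hV : ∀ i, IsOpen (V i) := by
    intro i
    have : V i = ⋃ e ∈ {e | e ∈ survivor ω ∧ proj b e ∈ t i}, {y | ∀ j < n i, y j = e j} := by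
      ext d
      simp [V, and_assoc]
    rw [this]
    exact isOpen_biUnion fun e _ => isOpen_agree e _
  obtain ⟨I, hI⟩ := (isClosed_survivor ω).isCompact.elim_finite_subcover V hV (by
    intro d hd
    obtain ⟨i, hi⟩ := mem_iUnion.1 (hcov (mem_image_of_mem _ hd))
    exact mem_iUnion.2 ⟨i, d, hd, hi, fun _ _ => rfl⟩)
  -- Counting words at one level N beyond all levels involved replaces the use of a measure.
  let N := I.sup n
  have hW : ∀ k, (wordCount (survivor ω) k : ℝ≥0∞) ≠ 0 := fun k => by
    exact_mod_cast (wordCount_pos (survivor_nonempty (by omega) ω)).ne'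
  have h1 : wordCount (survivor ω) N ≤ ∑ i ∈ I, wordCount (survivor ω ∩ V i) N := by
    refine (wordCount_mono ?_).trans (wordCount_biUnion_le I _)
    intro d hd
    obtain ⟨i, hi, hdi⟩ := mem_iUnion₂.1 (hI hd)
    exact mem_iUnion₂.2 ⟨i, hi, hd, hdi⟩
  have h2 : ∀ i ∈ I, (wordCount (survivor ω ∩ V i) N : ℝ≥0∞) ≤
      wordCount (survivor ω) N *
        ((3 * b ^ (l + 1) : ℕ) * (wordCount (survivor ω) (n i) : ℝ≥0∞)⁻¹) := by
    intro i hi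
    have := wordCount_near_mul_le hb ω (Finset.le_sup hi : n i ≤ N) (ht i)
    rw [← mul_assoc, ← div_eq_mul_inv,
      ENNReal.le_div_iff_mul_le (Or.inl (hW _)) (Or.inl (ENNReal.natCast_ne_top _))]
    rw [mul_comm (3 * b ^ (l + 1))] at this
    exact_mod_cast this
  have h3 : (wordCount (survivor ω) N : ℝ≥0∞) * 1 ≤ wordCount (survivor ω) N *
      ∑ i ∈ I, ((3 * b ^ (l + 1) : ℕ) * (wordCount (survivor ω) (n i) : ℝ≥0∞)⁻¹) := by
    rw [mul_one, Finset.mul_sum]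
    refine le_trans ?_ (Finset.sum_le_sum h2)
    exact_mod_cast h1
  exact ((ENNReal.mul_le_mul_iff_right (hW _) (ENNReal.natCast_ne_top _)).1 h3).trans
    (ENNReal.sum_le_tsum I)

open MeasureTheory in
-- If the measure vanished, there would be covers with arbitrarily small sum of diam^s. Rounding
-- diameters up to powers of 1/b costs a factor b^s, and then the counting bound gives 1 ≤ const · ε
-- for all ε > 0.
lemma hausdorffMeasure_ne_zero {b l : ℕ} (hb : 3 ≤ b) (ω : ℕ → Fin (l + 2) → Fin b) {s C : ℝ}
    (hs : 0 < s) (h : ∀ n : ℕ, (b : ℝ) ^ (s * n) ≤ C * wordCount (survivor ω) n) :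
    μH[s] (survivorSet ω) ≠ 0 := by
  have hb0 : 0 < b := by omega
  have hb' : (0 : ℝ) < b := by positivity
  intro h0
  have hWpos : ∀ k, (0 : ℝ) < wordCount (survivor ω) k := fun k => by
    exact_mod_cast wordCount_pos (survivor_nonempty (by omega) ω)
  have hW : ∀ k, (wordCount (survivor ω) k : ℝ≥0∞)⁻¹ ≤
      ENNReal.ofReal C * ENNReal.ofReal ((b : ℝ) ^ k)⁻¹ ^ s := by
    intro k
    have hC : 0 ≤ C := by
      have := h 0
      have h1 := hWpos 0
      by_contra! hC
      have : C * wordCount (survivor ω) 0 < 0 := mul_neg_of_neg_of_pos hC h1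
      have h2 : (0 : ℝ) < (b : ℝ) ^ (s * (0 : ℕ)) := by positivity
      linarith
    rw [ofReal_inv_pow_rpow hb0, ← ENNReal.ofReal_mul hC, ← ENNReal.ofReal_natCast,
      ← ENNReal.ofReal_inv_of_pos (hWpos k)]
    refine ENNReal.ofReal_le_ofReal ?_
    rw [← div_eq_mul_inv, le_div_iff₀ (by positivity), inv_mul_le_iff₀ (hWpos k), mul_comm _ C]
    exact h k
  -- A positive δ has a level with δ ≤ b^(-n) ≤ bδ. For δ = 0 no level is comparable, whence the
  -- additive ε, made summable over the cover below.
  have hlevel : ∀ (δ ε : ℝ≥0∞), δ ≤ 1 → 0 < ε → ∃ n : ℕ, δ ≤ ENNReal.ofReal ((b : ℝ) ^ n)⁻¹ ∧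
      ENNReal.ofReal ((b : ℝ) ^ n)⁻¹ ^ s ≤ ENNReal.ofReal (b : ℝ) ^ s * δ ^ s + ε := by
    intro δ ε hδ hε
    rcases eq_or_ne δ 0 with rfl | hδ0
    · have h1 := (tendsto_ofReal_inv_pow (b := b) (by omega)).ennrpow_const s
      rw [ENNReal.zero_rpow_of_pos hs] at h1
      obtain ⟨n, hn⟩ := ((tendsto_order.1 h1).2 ε hε).exists
      exact ⟨n, zero_le, hn.le.trans le_add_self⟩
    · lift δ to ℝ≥0 using ne_top_of_le_ne_top ENNReal.one_ne_top hδ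
      have hδ0' : 0 < δ := pos_iff_ne_zero.2 (by exact_mod_cast hδ0)
      have hb1 : (1 : ℝ) < b := by exact_mod_cast (by omega : 1 < b)
      obtain ⟨n, hn1, hn2⟩ := exists_nat_pow_near_of_lt_one (x := (δ : ℝ)) (y := (b : ℝ)⁻¹)
        (by exact_mod_cast hδ0') (by exact_mod_cast hδ) (by positivity) (inv_lt_one_of_one_lt₀ hb1)
      refine ⟨n, ?_, le_add_right ?_⟩
      · rw [← ENNReal.ofReal_coe_nnreal]
        refine ENNReal.ofReal_le_ofReal ?_
        rwa [inv_pow] at hn2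
      · rw [← ENNReal.mul_rpow_of_nonneg _ _ hs.le]
        refine ENNReal.rpow_le_rpow ?_ hs.le
        rw [← ENNReal.ofReal_coe_nnreal, ← ENNReal.ofReal_mul hb'.le]
        refine ENNReal.ofReal_le_ofReal ?_
        rw [pow_succ, inv_pow, ← div_eq_mul_inv, div_lt_iff₀ hb'] at hn1
        linarith
  have main : ∀ ε : ℝ≥0∞, 0 < ε → 1 ≤ (3 * b ^ (l + 1) : ℕ) * (ENNReal.ofReal C *
      (ENNReal.ofReal (b : ℝ) ^ s * ε + ε)) := by
    intro ε hε
    rw [Measure.hausdorffMeasure_apply] at h0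
    simp only [ENNReal.iSup_eq_zero] at h0
    have h1 := h0 1 one_pos
    have h2 := h1.trans_lt hε
    simp only [iInf_lt_iff] at h2
    obtain ⟨t, hcov, ht1, ht2⟩ := h2
    obtain ⟨ε', hε'0, hε'⟩ := ENNReal.exists_pos_sum_of_countable' hε.ne' ℕ
    choose n hn1 hn2 using fun i => hlevel (Metric.ediam (t i)) (ε' i) (ht1 i) (hε'0 i)
    refine (one_le_tsum_of_cover hb ω t n hn1 hcov).trans ?_
    rw [ENNReal.tsum_mul_left]
    gcongr
    calc ∑' i, (wordCount (survivor ω) (n i) : ℝ≥0∞)⁻¹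
        ≤ ∑' i, ENNReal.ofReal C *
          (ENNReal.ofReal (b : ℝ) ^ s * Metric.ediam (t i) ^ s + ε' i) :=
          ENNReal.tsum_le_tsum fun i => (hW _).trans (mul_le_mul_right (hn2 i) _)
      _ = ENNReal.ofReal C *
          (ENNReal.ofReal (b : ℝ) ^ s * ∑' i, Metric.ediam (t i) ^ s + ∑' i, ε' i) := by
          rw [ENNReal.tsum_mul_left, ENNReal.tsum_add, ENNReal.tsum_mul_left]
      _ ≤ _ := by
          gcongr
          refine le_trans (ENNReal.tsum_le_tsum fun i => ?_) ht2.le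
          rcases (t i).eq_empty_or_nonempty with h | h
          · simp [h, ENNReal.zero_rpow_of_pos hs]
          · simp [h]
  have hlim : Tendsto (fun ε : ℝ≥0∞ => (3 * b ^ (l + 1) : ℕ) * (ENNReal.ofReal C *
      (ENNReal.ofReal (b : ℝ) ^ s * ε + ε))) (𝓝[>] 0) (𝓝 0) := by
    have : Continuous fun ε : ℝ≥0∞ => ((3 * b ^ (l + 1) : ℕ) : ℝ≥0∞) * (ENNReal.ofReal C *
        (ENNReal.ofReal (b : ℝ) ^ s * ε + ε)) := by
      refine (ENNReal.continuous_const_mul (ENNReal.natCast_ne_top _)).comp ?_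
      refine (ENNReal.continuous_const_mul ENNReal.ofReal_ne_top).comp ?_
      exact (ENNReal.continuous_const_mul
        (ENNReal.rpow_ne_top_of_nonneg hs.le ENNReal.ofReal_ne_top)).add continuous_id
    have h1 := this.tendsto 0
    simp only [mul_zero, add_zero] at h1
    exact h1.mono_left nhdsWithin_le_nhds
  have h1 := ge_of_tendsto hlim (eventually_mem_nhdsWithin.mono fun ε hε => main ε hε)
  simp at h1

/-! ### Bounds for the packing measure -/

/-- A ball of radius in (b^(-n-1), b^(-n)] is coded by n and the first n + 1 letters of its centre.
Equal codes would put one centre inside the other ball, so there are at most W_(n+1) balls of scale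
n. -/
lemma packingPreAt_le {b m : ℕ} (hb : 2 ≤ b) (ω : ℕ → Fin m → Fin b) (s : ℝ≥0) :
    packingPreAt s 1 (survivorSet ω) ≤ ∑' n : ℕ, (wordCount (survivor ω) (n + 1) : ℝ≥0∞) *
      (ENNReal.ofReal 2 ^ (s : ℝ) * ENNReal.ofReal ((b : ℝ) ^ ((s : ℝ) * n))⁻¹) := by
  classical
  have hb0 : 0 < b := by omega
  have hb' : (0 : ℝ) < b := by positivity
  have hb1 : (1 : ℝ) < b := by exact_mod_cast (by omega : 1 < b)
  refine iSup₂_le fun P hP => ?_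
  obtain ⟨-, hP1, hP2⟩ := hP
  have hn : ∀ p : P, ∃ n : ℕ, (b : ℝ)⁻¹ ^ (n + 1) < p.1.2 ∧ p.1.2 ≤ (b : ℝ)⁻¹ ^ n := fun p =>
    exists_nat_pow_near_of_lt_one (hP1 _ p.2).2.1 (hP1 _ p.2).2.2 (by positivity)
      (inv_lt_one_of_one_lt₀ hb1)
  choose n hn1 hn2 using hn
  choose d hd1 hd2 using fun p : P => (hP1 _ p.2).1
  let f : P → Σ n : ℕ, ↥(pfx (n + 1) '' survivor ω) := fun p =>
    ⟨n p, pfx (n p + 1) (d p), mem_image_of_mem _ (hd1 p)⟩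
  have hf : Function.Injective f := by
    intro p q hpq
    have h1 : n p = n q := congrArg Sigma.fst hpq
    have h2 : ∀ i < n p + 1, d p i = d q i := by
      simp only [f, Sigma.mk.injEq] at hpq
      obtain ⟨-, h⟩ := hpq
      have key : ∀ (k k' : ℕ) (hk : k = k') (u : ↥(pfx (k + 1) '' survivor ω))
          (v : ↥(pfx (k' + 1) '' survivor ω)), u ≍ v →
          ∀ i (hi : i < k + 1), u.1 ⟨i, hi⟩ = v.1 ⟨i, hk ▸ hi⟩ := by
        rintro k _ rfl u v huv i hi
        rw [eq_of_heq huv]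
      exact key _ _ h1 _ _ h
    by_contra hne
    have h3 := hP2 p.2 q.2 (fun h => hne (Subtype.ext h))
    have h4 := abs_proj_sub_proj_le h2
    rw [hd2, hd2] at h4
    refine Set.disjoint_left.1 h3 (Metric.mem_closedBall_self (hP1 _ p.2).2.1.le) ?_
    rw [Metric.mem_closedBall, Real.dist_eq]
    have h5 := hn1 q
    rw [← h1, inv_pow] at h5
    exact h4.trans h5.le
  let g : (Σ n : ℕ, ↥(pfx (n + 1) '' survivor ω)) → ℝ≥0∞ := fun x =>
    ENNReal.ofReal 2 ^ (s : ℝ) * ENNReal.ofReal ((b : ℝ) ^ ((s : ℝ) * x.1))⁻¹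
  calc ∑' p : P, ENNReal.ofReal (2 * p.1.2) ^ (s : ℝ)
      ≤ ∑' p : P, g (f p) := by
        refine ENNReal.tsum_le_tsum fun p => ?_
        simp only [f, g]
        rw [← ofReal_inv_pow_rpow hb0, ← ENNReal.mul_rpow_of_nonneg _ _ s.coe_nonneg,
          ← ENNReal.ofReal_mul zero_le_two, ← inv_pow]
        refine ENNReal.rpow_le_rpow (ENNReal.ofReal_le_ofReal ?_) s.coe_nonneg
        linarith [hn2 p]
    _ ≤ ∑' x, g x := ENNReal.tsum_comp_le_tsum_of_injective hf g
    _ = _ := by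
        rw [ENNReal.tsum_sigma']
        refine tsum_congr fun k => ?_
        simp only [g]
        let _ := Fintype.ofFinite ↥(pfx (k + 1) '' survivor ω)
        rw [tsum_fintype, Finset.sum_const, Finset.card_univ, nsmul_eq_mul,
          ← Nat.card_eq_fintype_card, Nat.card_coe_set_eq]
        rfl

lemma packingMeasure_le_packingPre (s : ℝ≥0) (F : Set ℝ) : packingMeasure s F ≤ packingPre s F := by
  refine (iInf₂_le (fun n => if n = 0 then F else ∅)
    (fun x hx => mem_iUnion.2 ⟨0, by simpa using hx⟩)).trans ?_
  have h : ∀ n : ℕ, n ≠ 0 → packingPre s (if n = 0 then F else ∅) = 0 := by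
    intro n hn
    rw [if_neg hn, ← nonpos_iff_eq_zero]
    refine (iInf₂_le 1 one_pos).trans (iSup₂_le fun P hP => ?_)
    have : P = ∅ := eq_empty_of_forall_notMem fun p hp => (hP.2.1 p hp).1
    subst this
    simp
  rw [tsum_eq_single 0 h]
  simp

/-- The bound on the premeasure is a geometric series of ratio b^(t-s) < 1, so the trivial cover is
enough. -/
lemma packingMeasure_ne_top {b m : ℕ} (hb : 2 ≤ b) (ω : ℕ → Fin m → Fin b) {s : ℝ≥0} {t C : ℝ}
    (hts : t < s) (h : ∀ n : ℕ, (wordCount (survivor ω) n : ℝ) ≤ C * (b : ℝ) ^ (t * n)) :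
    packingMeasure s (survivorSet ω) ≠ ∞ := by
  have hb0 : 0 < b := by omega
  have hb' : (0 : ℝ) < b := by positivity
  have hb1 : (1 : ℝ) < b := by exact_mod_cast (by omega : 1 < b)
  refine ne_top_of_le_ne_top ?_ ((packingMeasure_le_packingPre _ _).trans
    ((iInf₂_le 1 one_pos).trans (packingPreAt_le hb ω s)))
  have hsum : Summable fun n : ℕ => C * (b : ℝ) ^ t * 2 ^ (s : ℝ) * ((b : ℝ) ^ (t - s)) ^ n :=
    (summable_geometric_of_lt_one (by positivity)
      (Real.rpow_lt_one_of_one_lt_of_neg hb1 (by linarith))).mul_left _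
  refine ne_top_of_le_ne_top hsum.tsum_ofReal_ne_top (ENNReal.tsum_le_tsum fun n => ?_)
  rw [ENNReal.ofReal_rpow_of_pos two_pos, ← ENNReal.ofReal_mul (by positivity),
    ← ENNReal.ofReal_natCast, ← ENNReal.ofReal_mul (by positivity)]
  refine ENNReal.ofReal_le_ofReal ?_
  calc (wordCount (survivor ω) (n + 1) : ℝ) * (2 ^ (s : ℝ) * ((b : ℝ) ^ ((s : ℝ) * n))⁻¹)
      ≤ C * (b : ℝ) ^ (t * ((n + 1 : ℕ) : ℝ)) * (2 ^ (s : ℝ) * ((b : ℝ) ^ ((s : ℝ) * n))⁻¹) := by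
        gcongr
        exact h (n + 1)
    _ = _ := by
        rw [← Real.rpow_natCast, ← Real.rpow_mul hb'.le, sub_mul, Real.rpow_sub hb']
        push_cast
        rw [mul_add, Real.rpow_add hb', mul_one]
        ring

/-- A set whose closure contains a cylinder of the survivor set has large packing premeasure. -/
lemma packingPre_eq_top {b l : ℕ} (hb : 3 ≤ b) (ω : ℕ → Fin (l + 2) → Fin b) {s : ℝ≥0} {t : ℝ}
    (hst : s < t) (h : ∃ᶠ n : ℕ in atTop, (b : ℝ) ^ (t * n) ≤ wordCount (survivor ω) n)
    {x : ℕ → Fin b} (hx : x ∈ survivor ω) (k : ℕ) {G : Set ℝ}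
    (hG : ∀ d ∈ survivorCyl ω x k, proj b d ∈ closure G) : packingPre s G = ∞ := by
  classical
  have hb0 : 0 < b := by omega
  have hb' : (0 : ℝ) < b := by positivity
  have hb1 : (1 : ℝ) < b := by exact_mod_cast (by omega : 1 < b)
  have hA : (0 : ℝ) < (3 * b ^ (l + 1) * wordCount (survivor ω) k : ℕ) := by
    have := wordCount_pos (n := k) (survivor_nonempty (by omega) ω)
    exact_mod_cast (by positivity)
  simp only [packingPre, iInf_eq_top]
  intro δ hδ
  have key : ∀ n : ℕ, 2⁻¹ * ((b : ℝ) ^ n)⁻¹ ≤ δ →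
      (b : ℝ) ^ (t * n) ≤ wordCount (survivor ω) n →
      ENNReal.ofReal ((3 * b ^ (l + 1) * wordCount (survivor ω) k : ℕ) : ℝ)⁻¹ *
        ENNReal.ofReal ((b : ℝ) ^ (t - s)) ^ n ≤ packingPreAt s δ G := by
    intro n hnδ hn
    obtain ⟨T, hT1, hT2, hT3⟩ := exists_separated (survivorCyl ω x k) n
    have hq : 0 < ((b : ℝ) ^ n)⁻¹ := by positivity
    -- Centres must lie in `G`, not in its closure. Moving each point by less than b^(-n)/4 leaves
    -- separation above b^(-n), so balls of radius b^(-n)/2 are disjoint.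
    have hy : ∀ d ∈ T, ∃ y ∈ G, dist (proj b d) y < 4⁻¹ * ((b : ℝ) ^ n)⁻¹ := fun d hd =>
      Metric.mem_closure_iff.1 (hG d (hT1 hd)) _ (by positivity)
    have : Nonempty ℝ := ⟨0⟩
    choose! y hy1 hy2 using hy
    have hsep : ∀ d ∈ T, ∀ e ∈ T, d ≠ e → ((b : ℝ) ^ n)⁻¹ < dist (y d) (y e) := by
      intro d hd e he hne
      have h1 := hT3 d hd e he hne
      rw [← Real.dist_eq] at h1
      have h2 := dist_triangle4 (proj b d) (y d) (y e) (proj b e)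
      have h3 := hy2 d hd
      have h4 := hy2 e he
      rw [dist_comm] at h4
      linarith
    let c : (ℕ → Fin b) → ℝ × ℝ := fun d => (y d, 2⁻¹ * ((b : ℝ) ^ n)⁻¹)
    have hc : Set.InjOn c T := by
      intro d hd e he hde
      by_contra hne
      have h1 := hsep d hd e he hne
      rw [show y d = y e from congrArg Prod.fst hde, dist_self] at h1
      linarith
    have hpack : IsPacking G δ (T.image c : Finset (ℝ × ℝ)) := by
      refine ⟨Finset.countable_toSet _, ?_, ?_⟩
      · intro p hp
        obtain ⟨d, hd, rfl⟩ := Finset.mem_image.1 hp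
        exact ⟨hy1 d hd, by positivity, hnδ⟩
      · intro p hp q hq hne
        obtain ⟨d, hd, rfl⟩ := Finset.mem_image.1 hp
        obtain ⟨e, he, rfl⟩ := Finset.mem_image.1 hq
        refine Metric.closedBall_disjoint_closedBall ?_
        have := hsep d hd e he (fun h => hne (by rw [h]))
        simp only [c]
        linarith
    refine le_trans ?_ (le_iSup₂ (f := fun (P : Set (ℝ × ℝ)) (_ : IsPacking G δ P) =>
      ∑' p : P, ENNReal.ofReal (2 * p.1.2) ^ (s : ℝ)) _ hpack)
    rw [Finset.tsum_subtype' (T.image c) (fun p => ENNReal.ofReal (2 * p.2) ^ (s : ℝ)),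
      Finset.sum_image hc]
    simp only [c, Finset.sum_const, nsmul_eq_mul]
    rw [mul_inv_cancel_left₀ two_ne_zero, ofReal_inv_pow_rpow hb0,
      ← ENNReal.ofReal_pow (by positivity), ← ENNReal.ofReal_mul (by positivity),
      ← ENNReal.ofReal_natCast, ← ENNReal.ofReal_mul (by positivity)]
    refine ENNReal.ofReal_le_ofReal ?_
    have h1 : wordCount (survivor ω) n ≤
        (3 * b ^ (l + 1) * wordCount (survivor ω) k) * T.card := by
      refine (wordCount_le_mul_wordCount_survivorCyl hb ω hx k n).trans ?_
      refine (Nat.mul_le_mul_left _ hT2).trans (le_of_eq ?_)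
      ring
    have h2 : (b : ℝ) ^ (t * n) ≤
        ((3 * b ^ (l + 1) * wordCount (survivor ω) k : ℕ) : ℝ) * T.card :=
      hn.trans (by exact_mod_cast h1)
    rw [inv_mul_le_iff₀ hA, ← Real.rpow_natCast, ← Real.rpow_mul hb'.le, sub_mul,
      Real.rpow_sub hb', div_eq_mul_inv, ← mul_assoc]
    gcongr
  have hlim : Tendsto (fun n : ℕ => ENNReal.ofReal
      ((3 * b ^ (l + 1) * wordCount (survivor ω) k : ℕ) : ℝ)⁻¹ *
        ENNReal.ofReal ((b : ℝ) ^ (t - s)) ^ n) atTop (𝓝 ∞) := by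
    have h1 : (1 : ℝ) < (b : ℝ) ^ (t - s) := Real.one_lt_rpow hb1 (by linarith)
    have h2 := (tendsto_pow_atTop_atTop_of_one_lt h1).const_mul_atTop (inv_pos.2 hA)
    refine (ENNReal.tendsto_ofReal_atTop.comp h2).congr fun n => ?_
    rw [Function.comp_apply, ENNReal.ofReal_mul (by positivity),
      ENNReal.ofReal_pow (by positivity)]
  have hsmall : ∀ᶠ n : ℕ in atTop, 2⁻¹ * ((b : ℝ) ^ n)⁻¹ ≤ δ := by
    have h1 := ((tendsto_pow_atTop_atTop_of_one_lt hb1).inv_tendsto_atTop).const_mul (2⁻¹ : ℝ)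
    rw [mul_zero] at h1
    exact (h1.eventually (gt_mem_nhds hδ)).mono fun n hn => hn.le
  refine ENNReal.eq_top_of_forall_nnreal_le fun M => ?_
  obtain ⟨n, hn, hn1, hn2⟩ := (h.and_eventually
    (hsmall.and (hlim.eventually (lt_mem_nhds (ENNReal.coe_lt_top (r := M)))))).exists
  exact hn2.le.trans (key n hn1 hn)

/-- Given a countable cover, the preimages of the closures cover the compact space Σ^ω. By Baire one
of them contains a cylinder, and the premeasure of that member is already infinite. -/
lemma packingMeasure_eq_top {b l : ℕ} (hb : 3 ≤ b) (ω : ℕ → Fin (l + 2) → Fin b) {s : ℝ≥0} {t : ℝ}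
    (hst : s < t) (h : ∃ᶠ n : ℕ in atTop, (b : ℝ) ^ (t * n) ≤ wordCount (survivor ω) n) :
    packingMeasure s (survivorSet ω) = ∞ := by
  simp only [packingMeasure, iInf_eq_top]
  intro G hG
  have : CompactSpace (survivor ω) := isCompact_iff_compactSpace.1 (isClosed_survivor ω).isCompact
  have : Nonempty (survivor ω) := (survivor_nonempty (by omega) ω).to_subtype
  obtain ⟨i, ⟨x, hx⟩, hxi⟩ := nonempty_interior_of_iUnion_of_closed
    (f := fun i => {d : survivor ω | proj b d ∈ closure (G i)})
    (fun i => isClosed_closure.preimage (continuous_proj.comp continuous_subtype_val))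
    (eq_univ_of_forall fun d => by
      obtain ⟨i, hi⟩ := mem_iUnion.1 (hG (mem_image_of_mem _ d.2))
      exact mem_iUnion.2 ⟨i, subset_closure hi⟩)
  obtain ⟨k, hk⟩ : ∃ k, ∀ d ∈ survivorCyl ω x k, proj b d ∈ closure (G i) := by
    rw [mem_interior_iff_mem_nhds, nhds_subtype_eq_comap, mem_comap] at hxi
    obtain ⟨U, hU, hUs⟩ := hxi
    obtain ⟨V, ⟨z, k, rfl⟩, hxV, hVU⟩ :=
      (PiNat.isTopologicalBasis_cylinders (fun _ : ℕ => Fin b)).mem_nhds_iff.1 hU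
    refine ⟨k, fun d hd => hUs (a := ⟨d, hd.1⟩) (hVU fun j hj => ?_)⟩
    exact (hd.2 j hj).trans (hxV j hj)
  exact ENNReal.tsum_eq_top_of_eq_top ⟨i, packingPre_eq_top hb ω hst h hx k hk⟩

/-! ### Products of adjacency matrices count words -/

lemma wordCount_biUnion_eq {b n : ℕ} {ι : Type*} (s : Finset ι) (A : ι → Set (ℕ → Fin b))
    (h : ∀ i ∈ s, ∀ j ∈ s, ∀ d ∈ A i, ∀ e ∈ A j, pfx n d = pfx n e → i = j) :
    wordCount (⋃ i ∈ s, A i) n = ∑ i ∈ s, wordCount (A i) n := by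
  have h1 := Set.Finite.ncard_biUnion s.finite_toSet (s := fun i => pfx n '' A i)
    (fun i _ => Set.toFinite _) (by
      intro i hi j hj hij
      refine Set.disjoint_left.2 ?_
      rintro _ ⟨d, hd, rfl⟩ ⟨e, he, hde⟩
      exact hij (h i hi j hj d hd e he hde.symm))
  rw [finsum_mem_coe_finset] at h1
  simpa [wordCount, image_iUnion] using h1

lemma wordCount_succ_of_const {b n : ℕ} {A : Set (ℕ → Fin b)} {a : Fin b} (h : ∀ d ∈ A, d n = a) :
    wordCount A (n + 1) = wordCount A n := by
  have h1 : pfx n '' A = (fun w : Fin (n + 1) → Fin b => fun i : Fin n => w i.castSucc) ''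
      (pfx (n + 1) '' A) := by
    rw [image_image]
    rfl
  have h2 : InjOn (fun w : Fin (n + 1) → Fin b => fun i : Fin n => w i.castSucc)
      (pfx (n + 1) '' A) := by
    rintro _ ⟨d, hd, rfl⟩ _ ⟨e, he, rfl⟩ hde
    rw [pfx_eq_iff]
    intro i hi
    rcases Nat.lt_succ_iff_lt_or_eq.1 hi with hi | rfl
    · exact congrFun hde ⟨i, hi⟩
    · rw [h d hd, h e he]
  rw [wordCount, wordCount, h1, h2.ncard_image]

/-- The sequences that avoid the first `n` holes and have the block `v` at position `n`. -/
def avoidingThrough {b l : ℕ} (ω : ℕ → Fin (l + 2) → Fin b) (n : ℕ) (v : Fin (l + 1) → Fin b) :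
    Set (ℕ → Fin b) :=
  avoiding ω (Iio n) ∩ {d | ∀ i : Fin (l + 1), d (n + i) = v i}

lemma eq_of_pfx_eq_of_mem_avoidingThrough {b l n : ℕ} {ω : ℕ → Fin (l + 2) → Fin b}
    {x y : Fin (l + 1) → Fin b} {d e : ℕ → Fin b} (hd : d ∈ avoidingThrough ω n x)
    (he : e ∈ avoidingThrough ω n y) (h : pfx (l + 1 + n) d = pfx (l + 1 + n) e) : x = y := by
  funext i
  rw [← hd.2 i, ← he.2 i]
  exact pfx_eq_iff.1 h _ (by omega)

lemma snoc_eq_block {b l n : ℕ} {x : Fin (l + 1) → Fin b} {a : Fin b} {d : ℕ → Fin b}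
    (h : ∀ i : Fin (l + 1), d (n + i) = x i) (ha : d (n + (l + 1)) = a) :
    (Fin.snoc x a : Fin (l + 2) → Fin b) = fun i : Fin (l + 2) => d (n + i) := by
  funext i
  induction i using Fin.lastCases with
  | last => simp [ha]
  | cast i => simp [h]

/-- Deleting the last letter, which `v` determines, leaves a word ending in a block `x`. The edge
condition from `x` to `v` says that the blocks overlap correctly and hole n is avoided. -/
lemma wordCount_avoidingThrough_succ {b l : ℕ} (ω : ℕ → Fin (l + 2) → Fin b) (n : ℕ)
    (v : Fin (l + 1) → Fin b) :
    (wordCount (avoidingThrough ω (n + 1) v) (l + 1 + (n + 1)) : ℝ) =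
      ∑ x, wordCount (avoidingThrough ω n x) (l + 1 + n) * adjMat (ω n) x v := by
  classical
  have h0 : ∀ d ∈ avoidingThrough ω (n + 1) v, d (l + 1 + n) = v (Fin.last l) := by
    intro d hd
    rw [← hd.2 (Fin.last l)]
    congr 1
    simp only [Fin.val_last]
    omega
  let s : Finset (Fin (l + 1) → Fin b) := Finset.univ.filter fun x =>
    (∀ i : Fin l, x i.succ = v i.castSucc) ∧
      (Fin.snoc x (v (Fin.last l)) : Fin (l + 2) → Fin b) ≠ ω n
  have h1 : wordCount (avoidingThrough ω (n + 1) v) (l + 1 + n) =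
      wordCount (⋃ x ∈ s, avoidingThrough ω n x) (l + 1 + n) := by
    unfold wordCount
    congr 1
    apply Subset.antisymm
    · refine image_mono fun d hd => ?_
      refine mem_iUnion₂.2 ⟨fun i => d (n + i), ?_, fun k hk => hd.1 k (Nat.lt_succ_of_lt hk),
        fun _ => rfl⟩
      simp only [s, Finset.mem_filter, Finset.mem_univ, true_and]
      refine ⟨fun i => ?_, ?_⟩
      · rw [← hd.2 i.castSucc]
        congr 1
        simp only [Fin.val_succ, Fin.val_castSucc]
        omega
      · rw [snoc_eq_block (fun _ => rfl)]
        · exact hd.1 n (Nat.lt_succ_self n)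
        · rw [← h0 d hd, add_comm]
    · rintro _ ⟨d, hd, rfl⟩
      obtain ⟨x, hx, hd⟩ := mem_iUnion₂.1 hd
      simp only [s, Finset.mem_filter, Finset.mem_univ, true_and] at hx
      -- The first n holes see only positions below l + 1 + n, so rewriting the letter there does
      -- not disturb them.
      have hne : ∀ i < l + 1 + n, Function.update d (l + 1 + n) (v (Fin.last l)) i = d i :=
        fun i hi => Function.update_of_ne hi.ne _ _
      have hlast : Function.update d (l + 1 + n) (v (Fin.last l)) (l + 1 + n) = v (Fin.last l) :=
        Function.update_self _ _ _
      refine ⟨Function.update d (l + 1 + n) (v (Fin.last l)), ⟨?_, ?_⟩, pfx_eq_iff.2 hne⟩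
      · intro k hk
        rcases Nat.lt_succ_iff_lt_or_eq.1 hk with hk | rfl
        · convert hd.1 k hk using 1
          funext i
          exact hne _ (by omega)
        · rw [← snoc_eq_block (x := x) (a := v (Fin.last l))]
          · exact hx.2
          · intro i
            rw [hne _ (by omega), hd.2 i]
          · rw [add_comm k, hlast]
      · intro i
        induction i using Fin.lastCases with
        | last => rw [← hlast]; congr 1; simp only [Fin.val_last]; omega
        | cast i =>
          rw [hne _ (by simp only [Fin.val_castSucc]; omega), ← hx.1 i, ← hd.2 i.succ]
          congr 1
          simp only [Fin.val_succ, Fin.val_castSucc]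
          omega
  have h2 := wordCount_biUnion_eq (n := l + 1 + n) s (avoidingThrough ω n)
    fun x _ y _ d hd e he h => eq_of_pfx_eq_of_mem_avoidingThrough hd he h
  rw [show l + 1 + (n + 1) = l + 1 + n + 1 from rfl, wordCount_succ_of_const h0, h1, h2]
  push_cast
  simp only [s, Finset.sum_filter]
  refine Finset.sum_congr rfl fun x _ => ?_
  simp only [adjMat, Matrix.of_apply, mul_ite, mul_one, mul_zero]

lemma adjProd_succ {b l : ℕ} (ω : ℕ → Fin (l + 2) → Fin b) (n : ℕ) :
    adjProd ω (n + 1) = adjProd ω n * adjMat (ω n) := by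
  simp [adjProd, List.range_succ]

lemma adjProd_nonneg {b l : ℕ} (ω : ℕ → Fin (l + 2) → Fin b) (n : ℕ)
    (u v : Fin (l + 1) → Fin b) : 0 ≤ adjProd ω n u v := by
  induction n generalizing v with
  | zero =>
    simp only [adjProd, List.range_zero, List.map_nil, List.prod_nil, Matrix.one_apply]
    split_ifs <;> norm_num
  | succ n ih =>
    rw [adjProd_succ, Matrix.mul_apply]
    refine Finset.sum_nonneg fun x _ => mul_nonneg (ih x) ?_
    simp only [adjMat, Matrix.of_apply]
    split_ifs <;> norm_num

lemma sum_adjProd_apply {b l : ℕ} (ω : ℕ → Fin (l + 2) → Fin b) (n : ℕ)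
    (v : Fin (l + 1) → Fin b) :
    ∑ u, adjProd ω n u v = wordCount (avoidingThrough ω n v) (l + 1 + n) := by
  induction n generalizing v with
  | zero =>
    have h1 : pfx (l + 1 + 0) '' avoidingThrough ω 0 v = {v} := by
      ext w
      simp only [mem_image, mem_singleton_iff]
      constructor
      · rintro ⟨d, hd, rfl⟩
        funext i
        have := hd.2 i
        rwa [zero_add] at this
      · rintro rfl
        refine ⟨fun i => w (Fin.ofNat (l + 1) i), ⟨fun k hk => absurd hk (by simp), fun i => ?_⟩, ?_⟩
        · simp
        · funext i
          simp only [pfx]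
          congr 1
          exact Fin.ext (Nat.mod_eq_of_lt i.2)
    rw [wordCount, h1]
    simp [adjProd, Matrix.one_apply]
  | succ n ih =>
    rw [wordCount_avoidingThrough_succ]
    simp only [adjProd_succ, Matrix.mul_apply]
    rw [Finset.sum_comm]
    refine Finset.sum_congr rfl fun x _ => ?_
    rw [← Finset.sum_mul, ih]

/-- Column sums count words avoiding the first n holes, sorted by final block; every such word
extends to a survivor. -/
lemma entryNorm_adjProd {b l : ℕ} (hb : 2 ≤ b) (ω : ℕ → Fin (l + 2) → Fin b) (n : ℕ) :
    entryNorm (adjProd ω n) = wordCount (survivor ω) (n + (l + 1)) := by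
  have h1 : wordCount (survivor ω) (l + 1 + n) =
      wordCount (⋃ x ∈ Finset.univ, avoidingThrough ω n x) (l + 1 + n) := by
    unfold wordCount
    congr 1
    apply Subset.antisymm
    · refine image_mono fun d hd => ?_
      exact mem_iUnion₂.2 ⟨fun i => d (n + i), Finset.mem_univ _,
        survivor_subset_avoiding ω _ hd, fun _ => rfl⟩
    · rintro _ ⟨d, hd, rfl⟩
      obtain ⟨x, -, hd⟩ := mem_iUnion₂.1 hd
      obtain ⟨e, he, hed⟩ := exists_survivor_extension hb ω n hd.1
      exact ⟨e, he, pfx_eq_iff.2 fun i hi => hed i (by omega)⟩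
  rw [add_comm n, h1, wordCount_biUnion_eq _ _
    fun x _ y _ d hd e he h => eq_of_pfx_eq_of_mem_avoidingThrough hd he h]
  push_cast
  simp only [entryNorm, abs_of_nonneg (adjProd_nonneg ω n _ _)]
  exact Finset.sum_comm.trans (Finset.sum_congr rfl fun v _ => sum_adjProd_apply ω n v)

/-! ### Box counting -/

lemma boxCount_le_wordCount {b m : ℕ} (ω : ℕ → Fin m → Fin b) {δ : ℝ} {n : ℕ}
    (h : ((b : ℝ) ^ n)⁻¹ ≤ δ) : boxCount δ (survivorSet ω) ≤ wordCount (survivor ω) n := by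
  let _ := Fintype.ofFinite ↥(pfx n '' survivor ω)
  let e : Fin (wordCount (survivor ω) n) ≃ ↥(pfx n '' survivor ω) :=
    (Finite.equivFinOfCardEq (Nat.card_coe_set_eq _)).symm
  refine iInf₂_le _ ⟨fun i => proj b '' {d | d ∈ survivor ω ∧ pfx n d = e i}, fun i => ?_, ?_⟩
  · exact (ediam_proj_image_le fun d hd e he =>
      pfx_eq_iff.1 (hd.2.trans he.2.symm)).trans (ENNReal.ofReal_le_ofReal h)
  · rintro _ ⟨d, hd, rfl⟩
    refine mem_iUnion.2 ⟨e.symm ⟨_, mem_image_of_mem _ hd⟩, d, ⟨hd, ?_⟩, rfl⟩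
    rw [e.apply_symm_apply]

lemma wordCount_le_of_boxCount_eq {b m : ℕ} (ω : ℕ → Fin m → Fin b) {δ : ℝ} {n B : ℕ}
    (h : δ ≤ ((b : ℝ) ^ n)⁻¹) (hB : boxCount δ (survivorSet ω) = B) :
    wordCount (survivor ω) n ≤ 3 * B := by
  have h1 : boxCount δ (survivorSet ω) < ((B + 1 : ℕ) : ℕ∞) := by
    rw [hB]
    exact_mod_cast Nat.lt_succ_self B
  simp only [boxCount, iInf_lt_iff] at h1
  obtain ⟨k, ⟨U, hU, hcov⟩, hk⟩ := h1
  have hk' : k < B + 1 := by exact_mod_cast hk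
  have h2 : survivor ω ⊆ ⋃ i, {d | proj b d ∈ U i} := fun d hd => by
    simpa using hcov (mem_image_of_mem _ hd)
  calc wordCount (survivor ω) n ≤ ∑ i, wordCount {d | proj b d ∈ U i} n :=
        (wordCount_mono h2).trans (wordCount_iUnion_le _)
    _ ≤ ∑ _i : Fin k, 3 := Finset.sum_le_sum fun i _ =>
        wordCount_le_three ((hU i).trans (ENNReal.ofReal_le_ofReal h)) fun d hd => hd
    _ ≤ 3 * B := by
        simp only [Finset.sum_const, Finset.card_univ, Fintype.card_fin, smul_eq_mul]
        omega

/-! ### Comparison of lower and upper limits -/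

lemma liminf_coe_le_of_tendsto_sub {α : Type*} {F : Filter α} {f g : α → ℝ}
    (h : Tendsto (fun a => f a - g a) F (𝓝 0)) :
    liminf (fun a => (f a : EReal)) F ≤ liminf (fun a => (g a : EReal)) F := by
  refine EReal.ge_of_forall_gt_iff_ge.1 fun z hz => ?_
  obtain ⟨w, hzw, hw⟩ := EReal.lt_iff_exists_real_btwn.1 hz
  have hzw' : z < w := by exact_mod_cast hzw
  refine le_liminf_of_le (by isBoundedDefault) ?_
  filter_upwards [eventually_lt_of_lt_liminf hw, h.eventually (gt_mem_nhds (sub_pos.2 hzw'))]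
    with a h1 h2
  have h1' : w < f a := by exact_mod_cast h1
  exact_mod_cast (by linarith : z ≤ g a)

lemma limsup_coe_le_of_tendsto_sub {α : Type*} {F : Filter α} {f g : α → ℝ}
    (h : Tendsto (fun a => f a - g a) F (𝓝 0)) :
    limsup (fun a => (f a : EReal)) F ≤ limsup (fun a => (g a : EReal)) F := by
  refine EReal.le_of_forall_lt_iff_le.1 fun z hz => ?_
  obtain ⟨w, hw, hwz⟩ := EReal.lt_iff_exists_real_btwn.1 hz
  have hwz' : w < z := by exact_mod_cast hwz
  refine limsup_le_of_le (by isBoundedDefault) ?_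
  filter_upwards [eventually_lt_of_limsup_lt hw, h.eventually (gt_mem_nhds (sub_pos.2 hwz'))]
    with a h1 h2
  have h1' : g a < w := by exact_mod_cast h1
  exact_mod_cast (by linarith : f a ≤ z)

lemma tendsto_sub_zero_symm {α : Type*} {F : Filter α} {f g : α → ℝ}
    (h : Tendsto (fun a => f a - g a) F (𝓝 0)) : Tendsto (fun a => g a - f a) F (𝓝 0) := by
  simpa using h.neg

lemma liminf_coe_eq_of_tendsto_sub {α : Type*} {F : Filter α} {f g : α → ℝ}
    (h : Tendsto (fun a => f a - g a) F (𝓝 0)) :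
    liminf (fun a => (f a : EReal)) F = liminf (fun a => (g a : EReal)) F :=
  (liminf_coe_le_of_tendsto_sub h).antisymm (liminf_coe_le_of_tendsto_sub (tendsto_sub_zero_symm h))

lemma limsup_coe_eq_of_tendsto_sub {α : Type*} {F : Filter α} {f g : α → ℝ}
    (h : Tendsto (fun a => f a - g a) F (𝓝 0)) :
    limsup (fun a => (f a : EReal)) F = limsup (fun a => (g a : EReal)) F :=
  (limsup_coe_le_of_tendsto_sub h).antisymm (limsup_coe_le_of_tendsto_sub (tendsto_sub_zero_symm h))

/-! ### The growth rate of the number of words -/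

lemma one_le_wordCount_survivor {b l : ℕ} (hb : 2 ≤ b) (ω : ℕ → Fin (l + 2) → Fin b) (n : ℕ) :
    (1 : ℝ) ≤ wordCount (survivor ω) n := by
  exact_mod_cast wordCount_pos (survivor_nonempty hb ω)

lemma wordRate_eq {b m : ℕ} (ω : ℕ → Fin m → Fin b) (n : ℕ) :
    wordRate ω n = Real.log (wordCount (survivor ω) n) / (n * Real.log b) := rfl

lemma wordRate_nonneg {b m : ℕ} (ω : ℕ → Fin m → Fin b) (n : ℕ) : 0 ≤ wordRate ω n :=
  div_nonneg (Real.log_natCast_nonneg _) (mul_nonneg n.cast_nonneg (Real.log_natCast_nonneg _))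

lemma log_wordCount_le {b l : ℕ} (hb : 2 ≤ b) (ω : ℕ → Fin (l + 2) → Fin b) (n : ℕ) :
    Real.log (wordCount (survivor ω) n) ≤ n * Real.log b := by
  have h1 := one_le_wordCount_survivor hb ω n
  rw [← Real.log_pow]
  exact Real.log_le_log (by linarith) (by exact_mod_cast wordCount_le_pow _)

lemma le_wordRate_iff {b l n : ℕ} (hb : 2 ≤ b) (ω : ℕ → Fin (l + 2) → Fin b) (hn : 0 < n)
    (t : ℝ) : t ≤ wordRate ω n ↔ (b : ℝ) ^ (t * n) ≤ wordCount (survivor ω) n := by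
  have h1 := one_le_wordCount_survivor hb ω n
  have h2 : 0 < Real.log b := Real.log_pos (by exact_mod_cast hb)
  have hn' : (0 : ℝ) < n := by exact_mod_cast hn
  rw [wordRate_eq, le_div_iff₀ (by positivity), Real.rpow_le_iff_le_log (by positivity)
    (by linarith), mul_assoc]

lemma wordRate_le_iff {b l n : ℕ} (hb : 2 ≤ b) (ω : ℕ → Fin (l + 2) → Fin b) (hn : 0 < n)
    (t : ℝ) : wordRate ω n ≤ t ↔ (wordCount (survivor ω) n : ℝ) ≤ (b : ℝ) ^ (t * n) := by
  have h1 := one_le_wordCount_survivor hb ω n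
  have h2 : 0 < Real.log b := Real.log_pos (by exact_mod_cast hb)
  have hn' : (0 : ℝ) < n := by exact_mod_cast hn
  rw [wordRate_eq, div_le_iff₀ (by positivity), Real.le_rpow_iff_log_le (by linarith)
    (by positivity), mul_assoc]

lemma log_wordCount_add_le {b l : ℕ} (hb : 2 ≤ b) (ω : ℕ → Fin (l + 2) → Fin b) (n k : ℕ) :
    Real.log (wordCount (survivor ω) (n + k)) ≤
      k * Real.log b + Real.log (wordCount (survivor ω) n) := by
  have h1 := one_le_wordCount_survivor hb ω n
  have h2 := one_le_wordCount_survivor hb ω (n + k)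
  have hb' : (0 : ℝ) < b := by positivity
  rw [← Real.log_pow, ← Real.log_mul (by positivity) (by positivity)]
  exact Real.log_le_log (by linarith) (by exact_mod_cast wordCount_add_le _ n k)

/-- The norm counts words longer by l + 1 letters, which changes the rate by at most (l + 1)/n. -/
lemma tendsto_normRate_sub_wordRate {b l : ℕ} (hb : 2 ≤ b) (ω : ℕ → Fin (l + 2) → Fin b) :
    Tendsto (fun n => normRate ω n - wordRate ω n) atTop (𝓝 0) := by
  have hlog : 0 < Real.log b := Real.log_pos (by exact_mod_cast hb)
  refine squeeze_zero' (Eventually.of_forall fun n => ?_) ?_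
    (tendsto_const_div_atTop_nhds_zero_nat ((l : ℝ) + 1))
  · rw [normRate, entryNorm_adjProd hb, wordRate_eq, one_div_mul_eq_div, ← sub_div]
    refine div_nonneg (sub_nonneg.2 (Real.log_le_log ?_ ?_)) (by positivity)
    · linarith [one_le_wordCount_survivor hb ω n]
    · exact_mod_cast wordCount_le_add _ _ _
  · filter_upwards [eventually_gt_atTop 0] with n hn
    have hn' : (0 : ℝ) < n := by exact_mod_cast hn
    rw [normRate, entryNorm_adjProd hb, wordRate_eq, one_div_mul_eq_div, ← sub_div,
      div_le_div_iff₀ (by positivity) hn']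
    have := log_wordCount_add_le hb ω n (l + 1)
    push_cast at this
    nlinarith

/-- The level of the cylinders that are compared with sets of diameter `δ`. -/
noncomputable def boxLevel (b : ℕ) (δ : ℝ) : ℕ := ⌈-Real.log δ / Real.log b⌉₊

lemma tendsto_neg_log_nhdsGT_zero : Tendsto (fun δ : ℝ => -Real.log δ) (𝓝[>] 0) atTop :=
  tendsto_neg_atBot_atTop.comp Real.tendsto_log_nhdsGT_zero

/-- Equality of filters, not mere convergence, turns lower and upper limits in δ into those in n. It
holds because δ = b^(-n) attains every level. -/
lemma map_boxLevel {b : ℕ} (hb : 2 ≤ b) : map (boxLevel b) (𝓝[>] 0) = atTop := by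
  have hlog : 0 < Real.log b := Real.log_pos (by exact_mod_cast hb)
  have hb1 : (1 : ℝ) < b := by exact_mod_cast hb
  refine le_antisymm
    (tendsto_nat_ceil_atTop.comp (tendsto_neg_log_nhdsGT_zero.atTop_div_const hlog)) ?_
  have h1 : Tendsto (fun n : ℕ => ((b : ℝ) ^ n)⁻¹) atTop (𝓝[>] 0) :=
    tendsto_inv_atTop_nhdsGT_zero.comp (tendsto_pow_atTop_atTop_of_one_lt hb1)
  have h2 : boxLevel b ∘ (fun n : ℕ => ((b : ℝ) ^ n)⁻¹) = id := by
    funext n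
    simp [boxLevel, hlog.ne']
  calc atTop = map (boxLevel b) (map (fun n : ℕ => ((b : ℝ) ^ n)⁻¹) atTop) := by
        rw [map_map, h2, map_id]
    _ ≤ _ := map_mono h1

lemma boxRatio_near {b l : ℕ} (hb : 2 ≤ b) (ω : ℕ → Fin (l + 2) → Fin b) {δ : ℝ} (h0 : 0 < δ)
    (h1 : δ < 1) : ∃ r : ℝ, boxRatio (survivorSet ω) δ = r ∧
      |r - wordRate ω (boxLevel b δ)| ≤ (Real.log 3 + 2 * Real.log b) / -Real.log δ := by
  have hlog : 0 < Real.log b := Real.log_pos (by exact_mod_cast hb)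
  have hb' : (0 : ℝ) < b := by positivity
  have hX : 0 < -Real.log δ := neg_pos.2 (Real.log_neg h0 h1)
  obtain ⟨n, hn⟩ : ∃ n, boxLevel b δ = n + 1 :=
    Nat.exists_eq_succ_of_ne_zero (Nat.ceil_pos.2 (div_pos hX hlog)).ne'
  have hle : -Real.log δ ≤ (n + 1 : ℕ) * Real.log b := by
    rw [← hn, ← div_le_iff₀ hlog]
    exact Nat.le_ceil _
  have hge : n * Real.log b ≤ -Real.log δ := by
    rw [← le_div_iff₀ hlog]
    have := Nat.ceil_lt_add_one (div_pos hX hlog).le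
    rw [show ⌈-Real.log δ / Real.log b⌉₊ = n + 1 from hn] at this
    push_cast at this
    linarith
  -- Now b^(-n-1) ≤ δ ≤ b^(-n) gives W_n / 3 ≤ N_δ ≤ W_(n+1). The errors are log 3, one log b for
  -- passing from level n to n + 1, and one for replacing -log δ by (n + 1) log b.
  have hδ1 : ((b : ℝ) ^ (n + 1))⁻¹ ≤ δ := by
    rw [← Real.log_le_log_iff (by positivity) h0, Real.log_inv, Real.log_pow]
    linarith
  have hδ2 : δ ≤ ((b : ℝ) ^ n)⁻¹ := by
    rw [← Real.log_le_log_iff h0 (by positivity), Real.log_inv, Real.log_pow]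
    linarith
  have hB1 := boxCount_le_wordCount ω hδ1
  obtain ⟨B, hB⟩ := ENat.ne_top_iff_exists.1 (ne_top_of_le_ne_top (ENat.natCast_ne_top _) hB1)
  have hB2 := wordCount_le_of_boxCount_eq ω hδ2 hB.symm
  rw [← hB] at hB1
  have hB3 : B ≤ wordCount (survivor ω) (n + 1) := by exact_mod_cast hB1
  have hW := one_le_wordCount_survivor hb ω n
  have hB2' : (wordCount (survivor ω) n : ℝ) ≤ 3 * B := by exact_mod_cast hB2
  have hBpos : (0 : ℝ) < B := by linarith
  refine ⟨Real.log B / -Real.log δ, ?_, ?_⟩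
  · rw [boxRatio, ← hB, EReal.coe_div]
    congr 1
    rw [← ENNReal.log_ofReal_of_pos hBpos]
    simp
  · rw [hn, wordRate_eq]
    have h3 : Real.log B ≤ Real.log (wordCount (survivor ω) (n + 1)) :=
      Real.log_le_log hBpos (by exact_mod_cast hB3)
    have h4 : Real.log (wordCount (survivor ω) n) ≤ Real.log 3 + Real.log B := by
      rw [← Real.log_mul (by norm_num) hBpos.ne']
      exact Real.log_le_log (by linarith) hB2'
    have h5 := log_wordCount_add_le hb ω n 1
    have h6 := log_wordCount_le hb ω (n + 1)
    have h7 : 0 ≤ Real.log (wordCount (survivor ω) (n + 1)) := Real.log_natCast_nonneg _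
    have h8 : 0 < Real.log 3 := Real.log_pos (by norm_num)
    generalize Real.log (wordCount (survivor ω) (n + 1)) = L at *
    generalize -Real.log δ = X at *
    have hY : 0 < ((n + 1 : ℕ) : ℝ) * Real.log b := by positivity
    have hYX : ((n + 1 : ℕ) : ℝ) * Real.log b ≤ X + Real.log b := by push_cast; linarith
    generalize ((n + 1 : ℕ) : ℝ) * Real.log b = Y at *
    have h9 : L / Y ≤ L / X := by gcongr
    have h10 : L / X - L / Y ≤ Real.log b / X := by
      have : L / X - L / Y = L / Y * ((Y - X) / X) := by field_simp
      rw [this]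
      calc L / Y * ((Y - X) / X) ≤ 1 * ((Y - X) / X) := by
            refine mul_le_mul_of_nonneg_right (div_le_one_of_le₀ h6 hY.le)
              (div_nonneg (by linarith) hX.le)
        _ ≤ Real.log b / X := by
            rw [one_mul]
            gcongr
            linarith
    have h11 : Real.log B / X ≤ L / X := by gcongr
    have h12 : L / X - (Real.log 3 + Real.log b) / X ≤ Real.log B / X := by
      rw [← sub_div]
      gcongr
      push_cast at h5
      linarith
    have h13 : 0 ≤ Real.log 3 / X := by positivity
    have h14 : 0 ≤ Real.log b / X := by positivity
    rw [add_div] at h12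
    rw [add_div, mul_div_assoc, abs_le]
    constructor <;> linarith

lemma exists_boxRatio_eq {b l : ℕ} (hb : 2 ≤ b) (ω : ℕ → Fin (l + 2) → Fin b) :
    ∃ f : ℝ → ℝ, boxRatio (survivorSet ω) =ᶠ[𝓝[>] 0] (fun δ => (f δ : EReal)) ∧
      Tendsto (fun δ => f δ - wordRate ω (boxLevel b δ)) (𝓝[>] 0) (𝓝 0) := by
  have hev : ∀ᶠ δ : ℝ in 𝓝[>] 0, 0 < δ ∧ δ < 1 := Ioo_mem_nhdsGT one_pos
  choose! f hf1 hf2 using fun (δ : ℝ) (h : 0 < δ ∧ δ < 1) => boxRatio_near hb ω h.1 h.2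
  refine ⟨f, hev.mono hf1, squeeze_zero_norm' (hev.mono hf2) ?_⟩
  exact tendsto_neg_log_nhdsGT_zero.const_div_atTop _

lemma lowerBoxDim_survivorSet {b l : ℕ} (hb : 2 ≤ b) (ω : ℕ → Fin (l + 2) → Fin b) :
    lowerBoxDim (survivorSet ω) = liminf (fun n : ℕ => (wordRate ω n : EReal)) atTop := by
  obtain ⟨f, hf1, hf2⟩ := exists_boxRatio_eq hb ω
  rw [lowerBoxDim, liminf_congr hf1, liminf_coe_eq_of_tendsto_sub hf2, ← map_boxLevel hb]
  rfl

lemma upperBoxDim_survivorSet {b l : ℕ} (hb : 2 ≤ b) (ω : ℕ → Fin (l + 2) → Fin b) :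
    upperBoxDim (survivorSet ω) = limsup (fun n : ℕ => (wordRate ω n : EReal)) atTop := by
  obtain ⟨f, hf1, hf2⟩ := exists_boxRatio_eq hb ω
  rw [upperBoxDim, limsup_congr hf1, limsup_coe_eq_of_tendsto_sub hf2, ← map_boxLevel hb]
  rfl

/-! ### Hausdorff and packing dimension -/

/-- The measure estimates need a bound at every level; a constant absorbs the finitely many
exceptions. -/
lemma exists_mul_bound_of_eventually {u v : ℕ → ℝ} (hv : ∀ n, 0 < v n)
    (h : ∀ᶠ n in atTop, u n ≤ v n) : ∃ C, ∀ n, u n ≤ C * v n := by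
  obtain ⟨N, hN⟩ := eventually_atTop.1 h
  refine ⟨1 + ∑ i ∈ Finset.range N, |u i / v i|, fun n => ?_⟩
  rw [← div_le_iff₀ (hv n)]
  have h0 : 0 ≤ ∑ i ∈ Finset.range N, |u i / v i| := Finset.sum_nonneg fun _ _ => abs_nonneg _
  rcases Nat.lt_or_ge n N with hn | hn
  · have := Finset.single_le_sum (f := fun i => |u i / v i|) (fun _ _ => abs_nonneg _)
      (Finset.mem_range.2 hn)
    linarith [le_abs_self (u n / v n)]
  · linarith [(div_le_one (hv n)).2 (hN n hn)]

lemma coe_nnreal_toEReal (s : ℝ≥0) : (((s : ℝ≥0∞) : EReal)) = ((s : ℝ) : EReal) := rfl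

lemma zero_le_liminf_wordRate {b m : ℕ} (ω : ℕ → Fin m → Fin b) :
    0 ≤ liminf (fun n : ℕ => (wordRate ω n : EReal)) atTop :=
  le_liminf_of_le (by isBoundedDefault)
    (Eventually.of_forall fun n => by exact_mod_cast wordRate_nonneg ω n)

lemma dimH_survivorSet {b l : ℕ} (hb : 3 ≤ b) (ω : ℕ → Fin (l + 2) → Fin b) :
    ((dimH (survivorSet ω) : ℝ≥0∞) : EReal) =
      liminf (fun n : ℕ => (wordRate ω n : EReal)) atTop := by
  have hb2 : 2 ≤ b := by omega
  have hb' : (0 : ℝ) < b := by positivity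
  apply le_antisymm
  · refine EReal.le_of_forall_lt_iff_le.1 fun z hz => ?_
    have hz0 : 0 ≤ z := by exact_mod_cast (zero_le_liminf_wordRate ω).trans hz.le
    lift z to ℝ≥0 using hz0
    have hfreq : ∃ᶠ n : ℕ in atTop, (wordCount (survivor ω) n : ℝ) ≤ (b : ℝ) ^ ((z : ℝ) * n) := by
      refine ((frequently_lt_of_liminf_lt (by isBoundedDefault) hz).and_eventually
        (eventually_gt_atTop 0)).mono fun n hn => ?_
      refine (wordRate_le_iff hb2 ω hn.2 _).1 ?_
      exact_mod_cast hn.1.le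
    have h1 := hausdorffMeasure_le_one hb2 ω z.2 hfreq
    have h2 := dimH_le_of_hausdorffMeasure_ne_top (ne_top_of_le_ne_top ENNReal.one_ne_top h1)
    rw [← coe_nnreal_toEReal]
    exact EReal.coe_ennreal_le_coe_ennreal_iff.2 h2
  · refine EReal.ge_of_forall_gt_iff_ge.1 fun z hz => ?_
    rcases le_or_gt z 0 with hz0 | hz0
    · exact le_trans (by exact_mod_cast hz0) (EReal.coe_ennreal_nonneg _)
    lift z to ℝ≥0 using hz0.le
    have hev : ∀ᶠ n : ℕ in atTop, (b : ℝ) ^ ((z : ℝ) * n) ≤ wordCount (survivor ω) n := by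
      filter_upwards [eventually_lt_of_lt_liminf hz, eventually_gt_atTop 0] with n h1 h2
      refine (le_wordRate_iff hb2 ω h2 _).1 ?_
      exact_mod_cast h1.le
    obtain ⟨C, hC⟩ := exists_mul_bound_of_eventually
      (fun n => lt_of_lt_of_le one_pos (one_le_wordCount_survivor hb2 ω n)) hev
    have h2 := le_dimH_of_hausdorffMeasure_ne_zero (hausdorffMeasure_ne_zero hb ω hz0 hC)
    rw [← coe_nnreal_toEReal]
    exact EReal.coe_ennreal_le_coe_ennreal_iff.2 h2

lemma dimP_survivorSet {b l : ℕ} (hb : 3 ≤ b) (ω : ℕ → Fin (l + 2) → Fin b) :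
    ((dimP (survivorSet ω) : ℝ≥0∞) : EReal) =
      limsup (fun n : ℕ => (wordRate ω n : EReal)) atTop := by
  have hb2 : 2 ≤ b := by omega
  have hb' : (0 : ℝ) < b := by positivity
  apply le_antisymm
  · refine EReal.le_of_forall_lt_iff_le.1 fun z hz => ?_
    have hz0 : 0 ≤ z := by
      exact_mod_cast ((zero_le_liminf_wordRate ω).trans liminf_le_limsup).trans hz.le
    lift z to ℝ≥0 using hz0
    have hev : ∀ᶠ n : ℕ in atTop, (wordCount (survivor ω) n : ℝ) ≤ (b : ℝ) ^ ((z : ℝ) * n) := by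
      filter_upwards [eventually_lt_of_limsup_lt hz, eventually_gt_atTop 0] with n h1 h2
      refine (wordRate_le_iff hb2 ω h2 _).1 ?_
      exact_mod_cast h1.le
    obtain ⟨C, hC⟩ := exists_mul_bound_of_eventually (fun n => by positivity) hev
    rw [← coe_nnreal_toEReal]
    refine EReal.coe_ennreal_le_coe_ennreal_iff.2 (iSup₂_le fun s hs => ?_)
    by_contra! hlt
    exact packingMeasure_ne_top hb2 ω (by exact_mod_cast hlt) hC hs
  · refine EReal.ge_of_forall_gt_iff_ge.1 fun z hz => ?_
    rcases le_or_gt z 0 with hz0 | hz0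
    · exact le_trans (by exact_mod_cast hz0) (EReal.coe_ennreal_nonneg _)
    lift z to ℝ≥0 using hz0.le
    -- An exponent strictly above z is needed so that the packing sums, of order b^((t-z)n), are
    -- unbounded.
    obtain ⟨t, hzt, ht⟩ := EReal.lt_iff_exists_real_btwn.1 hz
    have hfreq : ∃ᶠ n : ℕ in atTop, (b : ℝ) ^ (t * n) ≤ wordCount (survivor ω) n := by
      refine ((frequently_lt_of_lt_limsup (by isBoundedDefault) ht).and_eventually
        (eventually_gt_atTop 0)).mono fun n hn => ?_
      refine (le_wordRate_iff hb2 ω hn.2 _).1 ?_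
      exact_mod_cast hn.1.le
    rw [← coe_nnreal_toEReal]
    exact EReal.coe_ennreal_le_coe_ennreal_iff.2
      (le_iSup₂_of_le z (packingMeasure_eq_top hb ω (by exact_mod_cast hzt) hfreq) le_rfl)

end MovingHole

/-- The block length is `m = l + 2`, that is, an arbitrary integer `m ≥ 2`. All the dimensions and
all the lower and upper limits are compared in the extended reals. -/
theorem theorem1p1 (b l : ℕ) (hb : 3 ≤ b) (ω : ℕ → Fin (l + 2) → Fin b) :
    (((dimH (MovingHole.survivorSet ω) : ENNReal) : EReal)
          = MovingHole.lowerBoxDim (MovingHole.survivorSet ω) ∧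
        MovingHole.lowerBoxDim (MovingHole.survivorSet ω)
          = Filter.liminf (fun n : ℕ => ((MovingHole.wordRate ω n : ℝ) : EReal)) Filter.atTop ∧
        Filter.liminf (fun n : ℕ => ((MovingHole.wordRate ω n : ℝ) : EReal)) Filter.atTop
          = Filter.liminf (fun n : ℕ => ((MovingHole.normRate ω n : ℝ) : EReal)) Filter.atTop) ∧
      (((MovingHole.dimP (MovingHole.survivorSet ω) : ENNReal) : EReal)
          = MovingHole.upperBoxDim (MovingHole.survivorSet ω) ∧
        MovingHole.upperBoxDim (MovingHole.survivorSet ω)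
          = Filter.limsup (fun n : ℕ => ((MovingHole.wordRate ω n : ℝ) : EReal)) Filter.atTop ∧
        Filter.limsup (fun n : ℕ => ((MovingHole.wordRate ω n : ℝ) : EReal)) Filter.atTop
          = Filter.limsup (fun n : ℕ => ((MovingHole.normRate ω n : ℝ) : EReal))
              Filter.atTop) := by
  have hb2 : 2 ≤ b := by omega
  have h := MovingHole.tendsto_sub_zero_symm (MovingHole.tendsto_normRate_sub_wordRate hb2 ω)
  rw [MovingHole.dimH_survivorSet hb, MovingHole.dimP_survivorSet hb,
    MovingHole.lowerBoxDim_survivorSet hb2, MovingHole.upperBoxDim_survivorSet hb2]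
  exact ⟨⟨rfl, rfl, MovingHole.liminf_coe_eq_of_tendsto_sub h⟩,
    rfl, rfl, MovingHole.limsup_coe_eq_of_tendsto_sub h⟩
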